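/- Let $N$ be a free $\mathbb Z$-module of finite rank, $M=\operatorname{Hom}(N,\mathbb Z)$, and let $\Delta$ be a finite (not necessarily complete) smooth fan in $N_{\mathbb R}$, with toric variety $X$ over $\mathbb C$ and torus $T\subseteq X$. For $m\in M$ let $\mathbf e(m)$ be the corresponding character of $T$. Let $\Delta(1)$ be the set of one-dimensional cones of $\Delta$; for $\rho\in\Delta(1)$ let $n(\rho)\in N$ be the primitive generator of $\rho$ and $V(\rho)=\overline{\operatorname{orb}(\rho)}$ the corresponding prime divisor on $X$. Let $Y$ be a normal algebraic variety over $\mathbb C$ (in particular irreducible). Then the set of morphisms $f:Y\to X$ over $\mathbb C$ such that $f(Y)\cap T\neq\emptyset$ is in one-to-one correspondence with the set of pairs $(\{D(\rho)\}_{\rho\in\Delta(1)},\varepsilon)$ consisting of effective Weil divisors $D(\rho)$ on $Y$ such that $$D(\rho_1)\cap\cdots\cap D(\rho_s)=\emptyset\quad\text{whenever }\rho_1,\dots,\rho_s\in\Delta(1)\text{ and }\rho_1+\cdots+\rho_s\notin\Delta$$ (intersections being those of the supports), and a group homomorphism $$\varepsilon:M\to H^0\Bigl(Y\setminus\bigcup_{\rho\in\Delta(1)}D(\rho),\mathcal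 O_Y\Bigr)^{\times}$$ such that, as divisors on $Y$, $$\operatorname{div}(\varepsilon(m))=\sum_{\rho\in\Delta(1)}\langle m,n(\rho)\rangle D(\rho)\quad\text{for all }m\in M.$$ The pair corresponding to $f$ is the one for which $D(\rho)=f^{-1}(V(\rho))$ is the pulled-back divisor for each $\rho\in\Delta(1)$ (its multiplicity along a prime divisor $P$ of $Y$ is the length of $\mathcal O_{Y,P}/I_{V(\rho)}\mathcal O_{Y,P}$), $Y\setminus\bigcup_\rho D(\rho)=f^{-1}(T)$, and $\varepsilon(m)=f^*\mathbf e(m)$ for all $m\in M$. -/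

import Mathlib

open CategoryTheory CategoryTheory.Limits AlgebraicGeometry TopologicalSpace
open scoped TensorProduct

namespace Toric

section Lattice

variable (N : Type) [AddCommGroup N]

/-- The dual lattice `M = Hom(N, ℤ)`. -/
abbrev DualLattice : Type := N →ₗ[ℤ] ℤ

/-- The real vector space `N_ℝ = ℝ ⊗ N`. -/
abbrev RealSpace : Type := ℝ ⊗[ℤ] N

variable {N}

/-- The `ℝ`-linear extension `⟨m, ·⟩ : N_ℝ → ℝ` of `m ∈ M`. -/
noncomputable def realPairing (m : DualLattice N) : RealSpace N →ₗ[ℝ] ℝ :=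
  (TensorProduct.AlgebraTensorModule.rid ℤ ℝ ℝ).toLinearMap ∘ₗ m.baseChange ℝ

theorem realPairing_tmul (m : DualLattice N) (r : ℝ) (n : N) :
    realPairing m (r ⊗ₜ n) = (m n : ℝ) * r := by
  simp [realPairing]

theorem realPairing_zero : realPairing (0 : DualLattice N) = 0 := by
  ext; simp [realPairing_tmul]

theorem realPairing_add (m m' : DualLattice N) :
    realPairing (m + m') = realPairing m + realPairing m' := by
  ext; simp [realPairing_tmul]

theorem realPairing_neg (m : DualLattice N) : realPairing (-m) = -realPairing m := by
  ext; simp [realPairing_tmul]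

theorem realPairing_nsmul (k : ℕ) (m : DualLattice N) :
    realPairing (k • m) = k • realPairing m := by
  ext; simp [realPairing_tmul]

/-- The monoid `M ∩ σ^∨` of the `m ∈ M` that are nonnegative on the cone `σ`. -/
def dualMonoid (σ : PointedCone ℝ (RealSpace N)) : AddSubmonoid (DualLattice N) where
  carrier := {m | ∀ v ∈ σ, 0 ≤ realPairing m v}
  zero_mem' := by simp [realPairing_zero]
  add_mem' {a b} ha hb v hv := by
    rw [realPairing_add]; exact add_nonneg (ha v hv) (hb v hv)

theorem mem_dualMonoid {σ : PointedCone ℝ (RealSpace N)} {m : DualLattice N} :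
    m ∈ dualMonoid σ ↔ ∀ v ∈ σ, 0 ≤ realPairing m v := Iff.rfl

theorem dualMonoid_anti {σ τ : PointedCone ℝ (RealSpace N)} (h : τ ≤ σ) :
    dualMonoid σ ≤ dualMonoid τ := fun _ hm v hv => hm v (h hv)

/-- A cone is smooth if it is generated by a part of a `ℤ`-basis of `N`. -/
def IsSmoothCone (σ : PointedCone ℝ (RealSpace N)) : Prop :=
  ∃ (b : Module.Basis (Fin (Module.finrank ℤ N)) ℤ N) (s : Finset (Fin (Module.finrank ℤ N))),
    σ = PointedCone.hull ℝ ((fun i => (1 : ℝ) ⊗ₜ[ℤ] b i) '' s)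

variable (N) in
/-- A finite smooth fan in `N`. (Smooth cones are automatically rational, polyhedral and strongly
convex; given the closure under faces, containing the zero cone amounts to being nonempty.) -/
structure SmoothFan where
  cones : Set (PointedCone ℝ (RealSpace N))
  finite : cones.Finite
  smooth : ∀ σ ∈ cones, IsSmoothCone σ
  zero_mem : ⊥ ∈ cones
  face_mem : ∀ σ ∈ cones, ∀ τ : PointedCone ℝ (RealSpace N), τ.IsFaceOf σ → τ ∈ cones
  inter_isFaceOf : ∀ σ ∈ cones, ∀ τ ∈ cones, (σ ⊓ τ).IsFaceOf σ

/-- `m` is a supporting functional of the face `τ` of `σ`. -/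
def Supports (m : DualLattice N) (σ τ : PointedCone ℝ (RealSpace N)) : Prop :=
  ∀ v ∈ σ, 0 ≤ realPairing m v ∧ (realPairing m v = 0 ↔ v ∈ τ)

theorem Supports.add {m m' : DualLattice N} {σ τ τ' : PointedCone ℝ (RealSpace N)}
    (h : Supports m σ τ) (h' : Supports m' σ τ') : Supports (m + m') σ (τ ⊓ τ') := by
  intro v hv
  obtain ⟨h1, h2⟩ := h v hv
  obtain ⟨h3, h4⟩ := h' v hv
  rw [realPairing_add, LinearMap.add_apply]
  refine ⟨add_nonneg h1 h3, ?_⟩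
  rw [add_eq_zero_iff_of_nonneg h1 h3, h2, h4]; rfl

theorem mem_dualMonoid_hull {ι : Type*} {b : ι → N} {s : Set ι} {m : DualLattice N} :
    m ∈ dualMonoid (PointedCone.hull ℝ ((fun i => (1 : ℝ) ⊗ₜ[ℤ] b i) '' s)) ↔
      ∀ i ∈ s, 0 ≤ m (b i) := by
  constructor
  · intro h i hi
    have := h _ (Submodule.subset_span ⟨i, hi, rfl⟩)
    simpa [realPairing_tmul] using this
  · intro h v hv
    induction hv using Submodule.span_induction with
    | mem v hv =>
      obtain ⟨i, hi, rfl⟩ := hv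
      simpa [realPairing_tmul] using h i hi
    | zero => simp
    | add x y _ _ hx hy => rw [map_add]; exact add_nonneg hx hy
    | smul a x _ hx =>
      have : a • x = (a : ℝ) • x := rfl
      rw [this, map_smul]; exact mul_nonneg a.2 hx

theorem mem_hull_iff {ι : Type*} [Fintype ι] (b : ι → N) (s : Finset ι) (v : RealSpace N) :
    v ∈ PointedCone.hull ℝ ((fun i => (1 : ℝ) ⊗ₜ[ℤ] b i) '' s) ↔
      ∃ c : ι → ℝ, (∀ i, 0 ≤ c i) ∧ (∀ i ∉ s, c i = 0) ∧
        v = ∑ i, c i • ((1 : ℝ) ⊗ₜ[ℤ] b i) := by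
  classical
  constructor
  · intro hv
    induction hv using Submodule.span_induction with
    | mem v hv =>
      obtain ⟨i, hi, rfl⟩ := hv
      refine ⟨Pi.single i 1, fun j => ?_, fun j hj => ?_, ?_⟩
      · by_cases h : j = i
        · subst h; simp
        · simp [h]
      · rw [Pi.single_eq_of_ne]; rintro rfl; exact hj hi
      · simp [Pi.single_apply, ite_smul]
    | zero => exact ⟨0, by simp, by simp, by simp⟩
    | add x y _ _ hx hy =>
      obtain ⟨c, h1, h2, rfl⟩ := hx
      obtain ⟨d, h3, h4, rfl⟩ := hy
      exact ⟨c + d, fun i => add_nonneg (h1 i) (h3 i), fun i hi => by simp [h2 i hi, h4 i hi],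
        by simp [add_smul, Finset.sum_add_distrib]⟩
    | smul a x _ hx =>
      obtain ⟨c, h1, h2, rfl⟩ := hx
      refine ⟨fun i => a * c i, fun i => mul_nonneg a.2 (h1 i), fun i hi => by simp [h2 i hi], ?_⟩
      have : ∀ x : RealSpace N, a • x = (a : ℝ) • x := fun _ => rfl
      rw [this, Finset.smul_sum]
      simp [mul_smul]
  · rintro ⟨c, h1, h2, rfl⟩
    refine Submodule.sum_mem _ fun i _ => ?_
    by_cases hi : i ∈ s
    · exact PointedCone.smul_mem _ (h1 i) (Submodule.subset_span ⟨i, hi, rfl⟩)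
    · rw [h2 i hi, zero_smul]; exact zero_mem _

theorem exists_supports {σ τ : PointedCone ℝ (RealSpace N)} (hσ : IsSmoothCone σ)
    (hτ : τ.IsFaceOf σ) : ∃ m : DualLattice N, Supports m σ τ := by
  classical
  obtain ⟨b, s, rfl⟩ := hσ
  let g : Fin (Module.finrank ℤ N) → RealSpace N := fun i => (1 : ℝ) ⊗ₜ[ℤ] b i
  let u := s.filter (fun i => g i ∉ τ)
  have hm : ∀ i, (∑ j ∈ u, b.coord j) (b i) = if i ∈ u then 1 else 0 := by
    intro i
    simp [LinearMap.sum_apply, Finsupp.single_apply]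
  refine ⟨∑ j ∈ u, b.coord j, fun v hv => ?_⟩
  have hv' := hv
  rw [mem_hull_iff] at hv
  obtain ⟨c, h1, h2, rfl⟩ := hv
  have key : realPairing (∑ j ∈ u, b.coord j) (∑ i, c i • g i) = ∑ i ∈ u, c i := by
    rw [map_sum]
    simp only [map_smul, g, realPairing_tmul, hm, smul_eq_mul, mul_one]
    simp
  change 0 ≤ realPairing _ (∑ i, c i • g i) ∧ (realPairing _ (∑ i, c i • g i) = 0 ↔ _)
  rw [key, Finset.sum_eq_zero_iff_of_nonneg (fun i _ => h1 i)]
  refine ⟨Finset.sum_nonneg fun i _ => h1 i, fun h => ?_, fun h i hi => ?_⟩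
  · refine Submodule.sum_mem _ fun i _ => ?_
    by_cases hi : i ∈ s
    · by_cases hg : g i ∈ τ
      · exact PointedCone.smul_mem _ (h1 i) hg
      · rw [h i (by simp [u, hi, hg]), zero_smul]; exact zero_mem _
    · rw [h2 i hi, zero_smul]; exact zero_mem _
  · by_contra hne
    have hpos : 0 < c i := lt_of_le_of_ne (h1 i) (Ne.symm hne)
    obtain ⟨his, hiτ⟩ := Finset.mem_filter.1 hi
    apply hiτ
    have hrest : ∑ j ∈ Finset.univ.erase i, c j • g j ∈
        PointedCone.hull ℝ ((fun i => (1 : ℝ) ⊗ₜ[ℤ] b i) '' (s : Set _)) := by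
      refine Submodule.sum_mem _ fun j _ => ?_
      by_cases hj : j ∈ s
      · exact PointedCone.smul_mem _ (h1 j) (Submodule.subset_span ⟨j, hj, rfl⟩)
      · rw [h2 j hj, zero_smul]; exact zero_mem _
    refine hτ.mem_of_smul_add_mem (Submodule.subset_span ⟨i, his, rfl⟩) hrest hpos ?_
    rw [Finset.add_sum_erase _ (fun j => c j • g j) (Finset.mem_univ i)]
    exact h

theorem Supports.mem {m : DualLattice N} {σ τ : PointedCone ℝ (RealSpace N)}
    (h : Supports m σ τ) : m ∈ dualMonoid σ := fun v hv => (h v hv).1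

theorem Supports.neg_mem {m : DualLattice N} {σ τ : PointedCone ℝ (RealSpace N)}
    (h : Supports m σ τ) (hle : τ ≤ σ) : -m ∈ dualMonoid τ := fun v hv => by
  rw [realPairing_neg, LinearMap.neg_apply, ((h v (hle hv)).2).2 hv, neg_zero]

theorem Supports.exists_add_mem {m : DualLattice N} {σ τ : PointedCone ℝ (RealSpace N)}
    (h : Supports m σ τ) (hσ : IsSmoothCone σ) (k : DualLattice N)
    (hk : k ∈ dualMonoid τ) : ∃ n : ℕ, k + n • m ∈ dualMonoid σ := by
  obtain ⟨b, s, rfl⟩ := hσ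
  refine ⟨∑ i ∈ s, (k (b i)).natAbs, ?_⟩
  rw [mem_dualMonoid_hull]
  intro i hi
  obtain ⟨h1, h2⟩ := h _ (Submodule.subset_span ⟨i, hi, rfl⟩)
  simp only [realPairing_tmul, mul_one] at h1 h2
  norm_cast at h1 h2
  by_cases hτ : (1 : ℝ) ⊗ₜ[ℤ] b i ∈ τ
  · have h3 := hk _ hτ
    simp only [realPairing_tmul, mul_one] at h3
    norm_cast at h3
    simp [h2.2 hτ, h3]
  · have hpos : 1 ≤ m (b i) := by
      have : m (b i) ≠ 0 := fun h0 => hτ (h2.1 h0)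
      omega
    have hle : (k (b i)).natAbs ≤ ∑ i ∈ s, (k (b i)).natAbs :=
      Finset.single_le_sum (f := fun i => (k (b i)).natAbs) (fun _ _ => Nat.zero_le _) hi
    simp only [LinearMap.add_apply, LinearMap.smul_apply, nsmul_eq_mul]
    have h5 : ((k (b i)).natAbs : ℤ) ≤ ((∑ i ∈ s, (k (b i)).natAbs : ℕ) : ℤ) := by exact_mod_cast hle
    have h6 : -(k (b i)) ≤ ((k (b i)).natAbs : ℤ) := by omega
    nlinarith [Int.natCast_nonneg (∑ i ∈ s, (k (b i)).natAbs)]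

end Lattice

section Chart

variable {N : Type} [AddCommGroup N]

/-- The coordinate ring `ℂ[M ∩ σ^∨]` of the affine chart `U_σ`. -/
abbrev ChartRing (σ : PointedCone ℝ (RealSpace N)) : Type := AddMonoidAlgebra ℂ (dualMonoid σ)

/-- The monomial `e(m)` in `ℂ[M ∩ σ^∨]`. -/
noncomputable def monomial (σ : PointedCone ℝ (RealSpace N)) (m : dualMonoid σ) : ChartRing σ :=
  AddMonoidAlgebra.single m 1

/-- The inclusion `ℂ[M ∩ σ^∨] → ℂ[M ∩ τ^∨]` for `τ ⊆ σ`. -/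
noncomputable def chartRingMap {σ τ : PointedCone ℝ (RealSpace N)} (h : τ ≤ σ) :
    ChartRing σ →+* ChartRing τ :=
  AddMonoidAlgebra.mapDomainRingHom ℂ (AddSubmonoid.inclusion (dualMonoid_anti h))

theorem chartRingMap_single {σ τ : PointedCone ℝ (RealSpace N)} (h : τ ≤ σ) (m : dualMonoid σ)
    (r : ℂ) : chartRingMap h (AddMonoidAlgebra.single m r) =
      AddMonoidAlgebra.single ⟨m.1, dualMonoid_anti h m.2⟩ r := by
  simp [chartRingMap]; rfl

theorem chartRingMap_injective {σ τ : PointedCone ℝ (RealSpace N)} (h : τ ≤ σ) :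
    Function.Injective (chartRingMap h) :=
  AddMonoidAlgebra.mapDomain_injective (AddSubmonoid.inclusion_injective (dualMonoid_anti h))

theorem chartRingMap_refl (σ : PointedCone ℝ (RealSpace N)) :
    chartRingMap (le_refl σ) = RingHom.id _ := by
  rw [chartRingMap, ← AddMonoidAlgebra.mapDomainRingHom_id]; rfl

theorem chartRingMap_comp {σ τ υ : PointedCone ℝ (RealSpace N)} (h : τ ≤ σ) (h' : υ ≤ τ) :
    (chartRingMap h').comp (chartRingMap h) = chartRingMap (h'.trans h) := by
  rw [chartRingMap, chartRingMap, ← AddMonoidAlgebra.mapDomainRingHom_comp]; rfl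

theorem chartRingMap_isLocalization {σ τ : PointedCone ℝ (RealSpace N)} (h : τ ≤ σ)
    (hσ : IsSmoothCone σ) {m : DualLattice N} (hm : Supports m σ τ) :
    letI := (chartRingMap h).toAlgebra
    IsLocalization.Away (monomial σ ⟨m, hm.mem⟩) (ChartRing τ) := by
  let := (chartRingMap h).toAlgebra
  have hpow : ∀ n : ℕ, algebraMap (ChartRing σ) (ChartRing τ) (monomial σ ⟨m, hm.mem⟩) ^ n =
      AddMonoidAlgebra.single ⟨n • m, (dualMonoid τ).nsmul_mem (dualMonoid_anti h hm.mem) n⟩ 1 := by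
    intro n
    change chartRingMap h (monomial σ ⟨m, hm.mem⟩) ^ n = _
    rw [monomial, chartRingMap_single, AddMonoidAlgebra.single_pow, one_pow]
    rfl
  refine IsLocalization.Away.mk _ ?_ ?_ ?_
  · refine IsUnit.of_mul_eq_one (AddMonoidAlgebra.single ⟨-m, hm.neg_mem h⟩ 1) ?_
    have := hpow 1
    rw [pow_one] at this
    rw [this, AddMonoidAlgebra.single_mul_single, AddMonoidAlgebra.one_def, one_mul]
    congr 1
    ext1
    simp
  · intro z
    induction z using AddMonoidAlgebra.induction_linear with
    | zero => exact ⟨0, 0, by simp⟩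
    | add x y hx hy =>
      obtain ⟨n, a, ha⟩ := hx
      obtain ⟨k, c, hc⟩ := hy
      refine ⟨n + k, a * monomial σ ⟨m, hm.mem⟩ ^ k + c * monomial σ ⟨m, hm.mem⟩ ^ n, ?_⟩
      rw [map_add, map_mul, map_mul, map_pow, map_pow, ← ha, ← hc]
      ring
    | single k r =>
      obtain ⟨n, hn⟩ := hm.exists_add_mem hσ k.1 k.2
      refine ⟨n, AddMonoidAlgebra.single ⟨_, hn⟩ r, ?_⟩
      rw [hpow, AddMonoidAlgebra.single_mul_single, mul_one]
      exact (chartRingMap_single h ⟨_, hn⟩ r).symm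
  · intro a c hac
    exact ⟨0, by rw [chartRingMap_injective h hac]⟩

/-- The affine chart `U_σ = Spec ℂ[M ∩ σ^∨]`. -/
noncomputable abbrev chart (σ : PointedCone ℝ (RealSpace N)) : Scheme.{0} :=
  Spec (CommRingCat.of (ChartRing σ))

/-- The map `U_τ → U_σ` for `τ ⊆ σ`. -/
noncomputable def chartMap {σ τ : PointedCone ℝ (RealSpace N)} (h : τ ≤ σ) : chart τ ⟶ chart σ :=
  Spec.map (CommRingCat.ofHom (chartRingMap h))

theorem chartMap_isOpenImmersion {σ τ : PointedCone ℝ (RealSpace N)} (h : τ ≤ σ)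
    (hσ : IsSmoothCone σ) (hτ : τ.IsFaceOf σ) : IsOpenImmersion (chartMap h) := by
  obtain ⟨m, hm⟩ := exists_supports hσ hτ
  let := (chartRingMap h).toAlgebra
  have := chartRingMap_isLocalization h hσ hm
  exact IsOpenImmersion.of_isLocalization (R := ChartRing σ) (S := ChartRing τ)
    (monomial σ ⟨m, hm.mem⟩)

theorem range_chartMap {σ τ : PointedCone ℝ (RealSpace N)} (h : τ ≤ σ)
    (hσ : IsSmoothCone σ) {m : DualLattice N} (hm : Supports m σ τ) :
    Set.range (chartMap h) = 
      ((PrimeSpectrum.basicOpen (monomial σ ⟨m, hm.mem⟩) : Opens (PrimeSpectrum (ChartRing σ))) :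
        Set (PrimeSpectrum (ChartRing σ))) := by
  let := (chartRingMap h).toAlgebra
  have := chartRingMap_isLocalization h hσ hm
  exact PrimeSpectrum.localization_away_comap_range (ChartRing τ) (monomial σ ⟨m, hm.mem⟩)

end Chart

namespace SmoothFan

variable {N : Type} [AddCommGroup N] (Δ : SmoothFan N)

/-- The poset of cones of the fan, ordered by inclusion, i.e. by the face relation. -/
abbrev Cone : Type := {σ : PointedCone ℝ (RealSpace N) // σ ∈ Δ.cones}

/-- The zero cone. -/
def zeroCone : Δ.Cone := ⟨⊥, Δ.zero_mem⟩

theorem isFaceOf {σ τ : Δ.Cone} (h : τ ≤ σ) : τ.1.IsFaceOf σ.1 := by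
  have := Δ.inter_isFaceOf σ.1 σ.2 τ.1 τ.2
  rwa [inf_eq_right.2 (show τ.1 ≤ σ.1 from h)] at this

/-- The diagram of the affine charts `U_σ`, `σ ∈ Δ`, and of the inclusions `U_τ → U_σ` for faces
`τ` of `σ`. -/
noncomputable def charts : Δ.Cone ⥤ Scheme.{0} where
  obj σ := chart σ.1
  map {τ σ} f := chartMap (show τ.1 ≤ σ.1 from leOfHom f)
  map_id σ := by
    rw [chartMap, chartRingMap_refl]; exact Spec.map_id _
  map_comp {υ τ σ} f g := by
    simp only [chartMap]
    rw [← Spec.map_comp, ← CommRingCat.ofHom_comp, chartRingMap_comp]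

instance {σ τ : Δ.Cone} (f : τ ⟶ σ) : IsOpenImmersion (Δ.charts.map f) :=
  chartMap_isOpenImmersion (leOfHom f) (Δ.smooth σ.1 σ.2) (Δ.isFaceOf (leOfHom f))

instance : (Δ.charts ⋙ Scheme.forget).IsLocallyDirected where
  cond {τ₁ τ₂ σ} f₁ f₂ x₁ x₂ h := by
    have hσ := Δ.smooth σ.1 σ.2
    obtain ⟨m₁, hm₁⟩ := exists_supports hσ (Δ.isFaceOf (leOfHom f₁))
    obtain ⟨m₂, hm₂⟩ := exists_supports hσ (Δ.isFaceOf (leOfHom f₂))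
    let τ : Δ.Cone := ⟨τ₁.1 ⊓ τ₂.1,
      Δ.face_mem _ τ₁.2 _ (Δ.inter_isFaceOf τ₁.1 τ₁.2 τ₂.1 τ₂.2)⟩
    have l₁ : τ ≤ τ₁ := (inf_le_left : τ₁.1 ⊓ τ₂.1 ≤ τ₁.1)
    have l₂ : τ ≤ τ₂ := (inf_le_right : τ₁.1 ⊓ τ₂.1 ≤ τ₂.1)
    change Δ.charts.map f₁ x₁ = Δ.charts.map f₂ x₂ at h
    have h₁ : chartMap (leOfHom f₁) x₁ ∈ Set.range (chartMap (σ := σ.1) (leOfHom f₁)) := ⟨x₁, rfl⟩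
    have h₂ : chartMap (leOfHom f₂) x₂ ∈ Set.range (chartMap (σ := σ.1) (leOfHom f₂)) := ⟨x₂, rfl⟩
    rw [range_chartMap _ hσ hm₁] at h₁
    rw [range_chartMap _ hσ hm₂] at h₂
    have h' : chartMap (σ := σ.1) (leOfHom f₁) x₁ = chartMap (leOfHom f₂) x₂ := h
    rw [← h'] at h₂
    have hmul : monomial σ.1 ⟨m₁ + m₂, (hm₁.add hm₂).mem⟩ =
        monomial σ.1 ⟨m₁, hm₁.mem⟩ * monomial σ.1 ⟨m₂, hm₂.mem⟩ := by
      rw [monomial, monomial, monomial, AddMonoidAlgebra.single_mul_single, one_mul]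
      rfl
    have h₃ : chartMap (leOfHom f₁) x₁ ∈
        Set.range (chartMap (σ := σ.1) (τ := τ.1) (l₁.trans (leOfHom f₁))) := by
      rw [range_chartMap _ hσ (hm₁.add hm₂), hmul, PrimeSpectrum.basicOpen_mul]
      exact ⟨h₁, h₂⟩
    obtain ⟨z, hz⟩ := h₃
    have key : ∀ {υ : Δ.Cone} (l : τ ≤ υ) (g : υ ⟶ σ) (z : Δ.charts.obj τ),
        Δ.charts.map g (Δ.charts.map (homOfLE l) z) = Δ.charts.map (homOfLE l ≫ g) z := by
      intro υ l g z
      rw [Functor.map_comp, Scheme.Hom.comp_apply]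
    have e₁ : Δ.charts.map f₁ (Δ.charts.map (homOfLE l₁) z) = Δ.charts.map f₁ x₁ := 
      (key l₁ f₁ z).trans hz
    have e₂ : Δ.charts.map f₂ (Δ.charts.map (homOfLE l₂) z) = Δ.charts.map f₂ x₂ := 
      (key l₂ f₂ z).trans (hz.trans h')
    exact ⟨τ, homOfLE l₁, homOfLE l₂, z, (Δ.charts.map f₁).isOpenEmbedding.injective e₁,
      (Δ.charts.map f₂).isOpenEmbedding.injective e₂⟩

/-- The toric variety of the fan, glued from the charts `U_σ` along the inclusions of faces. -/
noncomputable def toricVariety : Scheme.{0} := colimit Δ.charts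

/-- The open immersion `U_σ → X`. -/
noncomputable def chartι (σ : Δ.Cone) : chart σ.1 ⟶ Δ.toricVariety := colimit.ι Δ.charts σ

instance (σ : Δ.Cone) : IsOpenImmersion (Δ.chartι σ) :=
  inferInstanceAs (IsOpenImmersion (colimit.ι Δ.charts σ))

/-- The structure morphism of the toric variety. -/
noncomputable def toSpecℂ : Δ.toricVariety ⟶ Spec (CommRingCat.of ℂ) :=
  colimit.desc Δ.charts
    { pt := Spec (CommRingCat.of ℂ)
      ι :=
        { app := fun σ => Spec.map (CommRingCat.ofHom (algebraMap ℂ (ChartRing σ.1)))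
          naturality := fun τ σ f => by
            change chartMap _ ≫ _ = _ ≫ 𝟙 _
            rw [Category.comp_id, chartMap, ← Spec.map_comp, ← CommRingCat.ofHom_comp]
            congr 2
            ext x
            simp [chartRingMap] } }

/-- The torus `T = U_{0}`, as an open subset of the toric variety. -/
noncomputable def torus : Δ.toricVariety.Opens := Δ.chartι Δ.zeroCone ''ᵁ ⊤

/-- The character `e(m)` as a regular function on the torus. -/
noncomputable def character (m : DualLattice N) : Γ(Δ.toricVariety, Δ.torus) :=
  ((Δ.chartι Δ.zeroCone).appIso ⊤).inv
    ((Scheme.ΓSpecIso (CommRingCat.of (ChartRing (N := N) ⊥))).inv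
      (monomial ⊥ ⟨m, fun v hv => by rw [(Submodule.mem_bot _).1 hv, map_zero]⟩))

/-- The torus orbit `orb(σ)`: the points of `U_σ` at which every monomial `e(m)` with
`m ∈ M ∩ σ^∨` and `m ∉ σ^⊥` vanishes. -/
def orbit (σ : Δ.Cone) : Set Δ.toricVariety :=
  Δ.chartι σ '' {x : chart σ.1 | ∀ m : dualMonoid σ.1, (∃ v ∈ σ.1, realPairing m.1 v ≠ 0) →
    monomial σ.1 m ∈ (show PrimeSpectrum (ChartRing σ.1) from x).asIdeal}

/-- The set `Δ(1)` of one-dimensional cones. -/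
abbrev Ray : Type :=
  {ρ : Δ.Cone // Module.finrank ℝ (Submodule.span ℝ (ρ.1 : Set (RealSpace N))) = 1}

noncomputable instance : Fintype Δ.Ray :=
  haveI : Finite Δ.Cone := Δ.finite
  Fintype.ofFinite _

/-- The divisor `V(ρ)`, the closure of `orb(ρ)`, as a closed set. -/
noncomputable def rayDivisor (ρ : Δ.Ray) : Closeds Δ.toricVariety := .closure (Δ.orbit ρ.1)

theorem exists_primitiveGenerator [Module.Free ℤ N] [Module.Finite ℤ N] (ρ : Δ.Ray) :
    ∃ n : N, n ≠ 0 ∧ (1 : ℝ) ⊗ₜ[ℤ] n ∈ ρ.1.1 ∧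
      ∀ n' : N, (1 : ℝ) ⊗ₜ[ℤ] n' ∈ ρ.1.1 → ∃ k : ℕ, n' = k • n := by
  classical
  obtain ⟨b, s, hs⟩ := Δ.smooth ρ.1.1 ρ.1.2
  let B : Module.Basis (Fin (Module.finrank ℤ N)) ℝ (RealSpace N) := b.baseChange ℝ
  have hB : ∀ i, B i = (1 : ℝ) ⊗ₜ[ℤ] b i := fun i => by simp [B]
  have hspan : Submodule.span ℝ (ρ.1.1 : Set (RealSpace N)) =
      Submodule.span ℝ (B '' (s : Set _)) := by
    apply le_antisymm
    · rw [Submodule.span_le]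
      intro v hv
      rw [hs] at hv
      obtain ⟨c, -, h2, rfl⟩ := (mem_hull_iff b s v).1 hv
      refine Submodule.sum_mem _ fun i _ => ?_
      by_cases hi : i ∈ s
      · exact Submodule.smul_mem _ _ (Submodule.subset_span ⟨i, hi, hB i⟩)
      · rw [h2 i hi, zero_smul]; exact Submodule.zero_mem _
    · refine Submodule.span_mono ?_
      rintro _ ⟨i, hi, rfl⟩
      rw [hs, hB]
      exact Submodule.subset_span ⟨i, hi, rfl⟩
  have hcard : s.card = 1 := by
    have h1 := ρ.2
    have h2 : LinearIndependent ℝ (fun i : s => B i) :=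
      B.linearIndependent.comp _ Subtype.val_injective
    have h3 := finrank_span_eq_card h2
    have h4 : Set.range (fun i : s => B i) = B '' (s : Set _) := by
      ext; simp
    rw [h4, ← hspan, h1] at h3
    simpa using h3.symm
  obtain ⟨i, rfl⟩ := Finset.card_eq_one.1 hcard
  refine ⟨b i, b.ne_zero i, ?_, fun n' hn' => ?_⟩
  · rw [hs]; exact Submodule.subset_span ⟨i, by simp, rfl⟩
  · rw [hs] at hn'
    obtain ⟨c, h1, h2, h3⟩ := (mem_hull_iff b {i} _).1 hn'
    have hc : ∀ j, ((b.coord j n' : ℤ) : ℝ) = c j := fun j => by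
      have := congrArg (realPairing (b.coord j)) h3
      simpa [realPairing_tmul, Finsupp.single_apply] using this
    refine ⟨(b.coord i n').toNat, b.ext_elem fun j => ?_⟩
    have hnn : 0 ≤ b.coord i n' := by
      have := h1 i
      rw [← hc i] at this
      exact_mod_cast this
    by_cases hj : j = i
    · subst hj
      simpa using hnn
    · have h0 : b.coord j n' = 0 := by
        have := hc j
        rw [h2 j (by simpa using hj)] at this
        exact_mod_cast this
      have h0' : b.repr n' j = 0 := h0
      simp [h0', Ne.symm hj]

/-- The primitive generator `n(ρ)` of the ray `ρ`: the generator of the monoid `ρ ∩ N`. -/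
noncomputable def primitiveGenerator [Module.Free ℤ N] [Module.Finite ℤ N] (ρ : Δ.Ray) : N :=
  (Δ.exists_primitiveGenerator ρ).choose

end SmoothFan

/-- A normal algebraic variety over `ℂ`: an integral separated scheme of finite type over `ℂ`
all of whose local rings are integrally closed. -/
structure NormalVariety where
  carrier : Scheme.{0}
  toSpecℂ : carrier ⟶ Spec (CommRingCat.of ℂ)
  [isIntegral : IsIntegral carrier]
  [isSeparated : IsSeparated toSpecℂ]
  [locallyOfFiniteType : LocallyOfFiniteType toSpecℂ]
  [quasiCompact : QuasiCompact toSpecℂ]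
  [isIntegrallyClosed : ∀ y : carrier, IsIntegrallyClosed (carrier.presheaf.stalk y)]

namespace NormalVariety

attribute [instance] isIntegral isSeparated locallyOfFiniteType quasiCompact isIntegrallyClosed

variable (Y : NormalVariety)

instance : IsLocallyNoetherian Y.carrier :=
  LocallyOfFiniteType.isLocallyNoetherian Y.toSpecℂ

/-- The prime divisors of `Y`, given by their generic points, the points of codimension one. -/
abbrev PrimeDivisor : Type := {P : Y.carrier // Order.coheight P = 1}

/-- Weil divisors: finite formal integral combinations of prime divisors. -/
abbrev WeilDivisor : Type := Y.PrimeDivisor →₀ ℤ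

variable {Y}

/-- The support of a Weil divisor, the union of the prime divisors that occur in it. -/
def WeilDivisor.supp (D : Y.WeilDivisor) : Closeds Y.carrier where
  carrier := ⋃ P ∈ D.support, closure {P.1}
  isClosed' := isClosed_biUnion_finset fun _ _ => isClosed_closure

/-- The complement of the union of the supports of finitely many Weil divisors. -/
def complement {ι : Type} [Finite ι] (D : ι → Y.WeilDivisor) : Y.carrier.Opens where
  carrier := (⋃ i, ((D i).supp : Set Y.carrier))ᶜ
  is_open' := (isClosed_iUnion_of_finite fun i => (D i).supp.isClosed).isOpen_compl

theorem genericPoint_mem_complement {ι : Type} [Finite ι] (D : ι → Y.WeilDivisor) :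
    genericPoint Y.carrier ∈ complement D := by
  change genericPoint Y.carrier ∈ (⋃ i, ((D i).supp : Set Y.carrier))ᶜ
  simp only [Set.mem_compl_iff, Set.mem_iUnion, not_exists]
  intro i hi
  obtain ⟨P, -, hP⟩ := Set.mem_iUnion₂.1 hi
  have h1 : P.1 ⤳ genericPoint Y.carrier := specializes_iff_mem_closure.2 hP
  have h2 : IsMax P.1 := fun y _ => by
    rw [Scheme.le_iff_specializes]
    exact h1.trans (genericPoint_specializes y)
  have := P.2
  rw [Order.coheight_eq_zero.2 h2] at this
  exact zero_ne_one this

instance {ι : Type} [Finite ι] (D : ι → Y.WeilDivisor) : Nonempty (complement D) :=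
  ⟨⟨_, genericPoint_mem_complement D⟩⟩

/-- The divisor `div(g)` on `Y` of the rational function given by a regular function `g` on a
nonempty open subset of `Y`, as the function that sends a prime divisor to the order of
vanishing of `g` along it. -/
noncomputable def div {U : Y.carrier.Opens} [Nonempty U] (g : Γ(Y.carrier, U)) :
    Y.PrimeDivisor → ℤ :=
  fun P => Scheme.ord (Y.carrier.germToFunctionField U g) P.1

/-- The stalk at `x` of a quasi-coherent ideal sheaf. -/
noncomputable def idealStalk {X : Scheme.{0}} (I : X.IdealSheafData) (x : X) : Ideal (X.presheaf.stalk x) :=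
  ⨆ (U : X.affineOpens) (hx : x ∈ U.1), (I.ideal U).map (X.presheaf.germ U.1 x hx).hom

/-- The multiplicity along the prime divisor `P` of the scheme-theoretic inverse image `f⁻¹(V)` of
a closed subset `V` of `X` (with its reduced structure): the length of the local ring
`𝒪_{Y,P} / I_V 𝒪_{Y,P}`. -/
noncomputable def inverseImageMultiplicity {X : Scheme.{0}} (f : Y.carrier ⟶ X) (V : Closeds X)
    (P : Y.PrimeDivisor) : ℕ∞ :=
  Module.length (Y.carrier.presheaf.stalk P.1) (Y.carrier.presheaf.stalk P.1 ⧸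
    (idealStalk (Scheme.IdealSheafData.vanishingIdeal V) (f P.1)).map (f.stalkMap P.1).hom)


end NormalVariety

namespace SmoothFan

variable {N : Type} [AddCommGroup N] [Module.Free ℤ N] [Module.Finite ℤ N] (Δ : SmoothFan N)
  (Y : NormalVariety)

/-- The morphisms `f : Y → X` over `ℂ` with `f(Y) ∩ T ≠ ∅`. -/
structure MorphismMeetingTorus where
  hom : Y.carrier ⟶ Δ.toricVariety
  comp_toSpecℂ : hom ≫ Δ.toSpecℂ = Y.toSpecℂ
  meets : (Set.range hom ∩ (Δ.torus : Set Δ.toricVariety)).Nonempty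

/-- The pairs `({D(ρ)}, ε)`: effective Weil divisors `D(ρ)` on `Y`, with empty common intersection
for every set of rays whose sum is not a cone of the fan, and a group homomorphism `ε` from `M` to
the units on the complement of the `D(ρ)` with `div(ε(m)) = ∑ ⟨m, n(ρ)⟩ D(ρ)`. -/
structure DivisorData where
  D : Δ.Ray → Y.WeilDivisor
  effective : ∀ ρ, 0 ≤ D ρ
  iInter_supp : ∀ A : Finset Δ.Ray, (⨆ ρ ∈ A, ρ.1.1) ∉ Δ.cones →
    ⋂ ρ ∈ A, ((D ρ).supp : Set Y.carrier) = ∅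
  ε : Multiplicative (DualLattice N) →* Γ(Y.carrier, NormalVariety.complement D)ˣ
  div_ε : ∀ m : DualLattice N,
    NormalVariety.div (ε (.ofAdd m) : Γ(Y.carrier, NormalVariety.complement D)) =
      ⇑(∑ ρ, m (Δ.primitiveGenerator ρ) • D ρ)

variable {Δ Y}

/-- The pair `({D(ρ)}, ε)` is the one attached to the morphism `f`: each `D(ρ)` is the pullback
`f⁻¹(V(ρ))`, the complement of the `D(ρ)` is `f⁻¹(T)`, and `ε(m)` is the pullback of the
character `e(m)` of the torus. -/
structure Corresponds (f : MorphismMeetingTorus Δ Y) (d : DivisorData Δ Y) : Prop where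
  multiplicity : ∀ (ρ : Δ.Ray) (P : Y.PrimeDivisor),
    NormalVariety.inverseImageMultiplicity f.hom (Δ.rayDivisor ρ) P = ((d.D ρ P).toNat : ℕ∞)
  preimage_torus : f.hom ⁻¹ᵁ Δ.torus = NormalVariety.complement d.D
  ε_eq : ∀ m : DualLattice N,
    (d.ε (.ofAdd m) : Γ(Y.carrier, NormalVariety.complement d.D)) =
      Y.carrier.presheaf.map (homOfLE preimage_torus.ge).op
        (f.hom.app Δ.torus (Δ.character m))

end SmoothFan

end Toric

/-!
The argument compares both sides through rational functions on `Y`.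

*From a morphism to a pair.* A cone of a smooth fan is generated by part of a basis, so each ray
`ρ` of `σ` has a dual vector `dualVector σ ρ`, and on the chart `U_σ` the divisor `V(ρ)` is cut out
by the single monomial `rayEquation` (`chartι_mem_rayDivisor`, `vanishingIdeal_rayDivisor`). If `f`
meets the torus, the generic point of `Y` maps into it, so the characters pull back to nonzero
rational functions, collected in `genericHom f`. Along a prime divisor `P` with `f P ∈ U_σ` the
multiplicity of `f⁻¹(V(ρ))` is the order of the pullback of `rayEquation`
(`inverseImageMultiplicity_eq_ord`). A homomorphism `M → ℤ` that is nonnegative on `M ∩ σ^∨` is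
determined by its values on the dual vectors (`addMonoidHom_eq_sum`), which gives the formula for
`div (f^* e(m))`. The supports of the pulled back divisors are the preimages of the `V(ρ)` because
every zero of a nonzero regular function lies on a prime divisor along which it vanishes
(`exists_primeDivisor_of_notMem_basicOpen`, from Krull's principal ideal theorem).

*Injectivity.* The supports of the `D(ρ)` say which `V(ρ)` contain `f y`, hence give a chart that
contains `f y`, namely that of the cone spanned by these rays (`mem_chartOpen_of_eq_iSup`). Two
morphisms with the same pair therefore send every `y` into a common chart, and near `y` they are
given by ring homomorphisms that agree because they agree in the function field.

*Surjectivity.* Given `(D, ε)`, the complement of the `D(ρ)` with `ρ` not in `σ` (`chartDomain`) is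
the prospective preimage of `U_σ`, and the condition on intersections says that these open sets
cover `Y`. For `m ∈ M ∩ σ^∨` the rational function `ε(m)` has nonnegative order along all prime
divisors there, and so is regular, since a normal Noetherian domain is the intersection of its
localizations at the primes of height one (`IsIntegrallyClosed.mem_range_algebraMap_of_height_one`).
The resulting local morphisms to the charts glue (`exists_hom`), and evaluating `div` at the dual
vectors recovers the `D(ρ)`.
-/

namespace Toric

/-! ### Rays and faces of a smooth cone -/

section Cones

variable {N : Type} [AddCommGroup N]

theorem Supports.isFaceOf {m : DualLattice N} {σ τ : PointedCone ℝ (RealSpace N)}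
    (h : Supports m σ τ) (hle : τ ≤ σ) : τ.IsFaceOf σ where
  le := hle
  mem_of_smul_add_mem {x y a} hx hy ha hxy := by
    have hxy0 := ((h _ (hle hxy)).2).2 hxy
    have hx0 := (h x hx).1
    have hy0 := (h y hy).1
    rw [map_add, map_smul, smul_eq_mul] at hxy0
    refine ((h x hx).2).1 ?_
    have h1 : 0 ≤ a * realPairing m x := mul_nonneg ha.le hx0
    have h2 : a * realPairing m x = 0 := by linarith
    exact (mul_eq_zero.1 h2).resolve_left ha.ne'

theorem tmul_injective [Module.Free ℤ N] :
    Function.Injective fun n : N => (1 : ℝ) ⊗ₜ[ℤ] n := by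
  intro x y hxy
  let b := Module.Free.chooseBasis ℤ N
  refine b.ext_elem fun i => ?_
  have := congrArg (realPairing (b.coord i)) hxy
  simpa [realPairing_tmul] using this

theorem hull_singleton_isFaceOf (b : Module.Basis (Fin (Module.finrank ℤ N)) ℤ N)
    (s : Finset (Fin (Module.finrank ℤ N))) {i : Fin (Module.finrank ℤ N)} (hi : i ∈ s) :
    (PointedCone.hull ℝ {(1 : ℝ) ⊗ₜ[ℤ] b i}).IsFaceOf
      (PointedCone.hull ℝ ((fun i => (1 : ℝ) ⊗ₜ[ℤ] b i) '' s)) := by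
  classical
  refine Supports.isFaceOf (m := ∑ j ∈ s.erase i, b.coord j) ?_ ?_
  · intro v hv
    obtain ⟨c, h1, h2, rfl⟩ := (mem_hull_iff b s v).1 hv
    have key : realPairing (∑ j ∈ s.erase i, b.coord j) (∑ k, c k • ((1 : ℝ) ⊗ₜ[ℤ] b k)) =
        ∑ k ∈ s.erase i, c k := by
      have : ∀ k, (∑ j ∈ s.erase i, b.coord j) (b k) = if k ∈ s.erase i then 1 else 0 := by
        intro k
        simp only [LinearMap.sum_apply, Module.Basis.coord_apply, Module.Basis.repr_self,
          Finsupp.single_apply, Finset.sum_ite_eq]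
      rw [map_sum]
      simp only [map_smul, realPairing_tmul, this, smul_eq_mul, mul_one]
      simp [-Finset.mem_erase]
    rw [key, Finset.sum_eq_zero_iff_of_nonneg fun k _ => h1 k]
    refine ⟨Finset.sum_nonneg fun k _ => h1 k, fun h => ?_, fun h k hk => ?_⟩
    · refine Submodule.sum_mem _ fun k _ => ?_
      by_cases hki : k = i
      · subst hki
        exact PointedCone.smul_mem _ (h1 k) (Submodule.subset_span rfl)
      · have : c k = 0 := by
          by_cases hk : k ∈ s
          · exact h k (Finset.mem_erase.2 ⟨hki, hk⟩)
          · exact h2 k hk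
        rw [this, zero_smul]
        exact zero_mem _
    · obtain ⟨a, ha⟩ := Submodule.mem_span_singleton.1 h
      have h3 := congrArg (realPairing (b.coord k)) ha
      have h4 : realPairing (b.coord k) (a • ((1 : ℝ) ⊗ₜ[ℤ] b i)) = 0 := by
        change realPairing (b.coord k) ((a : ℝ) • ((1 : ℝ) ⊗ₜ[ℤ] b i)) = 0
        rw [map_smul, realPairing_tmul]
        simp [(Finset.ne_of_mem_erase hk).symm]
      rw [h4] at h3
      simpa [realPairing_tmul, Finsupp.single_apply] using h3.symm
  · exact Submodule.span_mono (by rintro _ rfl; exact ⟨i, hi, rfl⟩)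

end Cones

namespace SmoothFan

variable {N : Type} [AddCommGroup N] (Δ : SmoothFan N)

theorem zeroCone_le (σ : Δ.Cone) : Δ.zeroCone ≤ σ := (bot_le : (⊥ : PointedCone ℝ _) ≤ σ.1)

open Classical in
/-- The finite set `σ(1)` of rays contained in the cone `σ`. -/
noncomputable def raysOf (σ : Δ.Cone) : Finset Δ.Ray := Finset.univ.filter fun ρ => ρ.1 ≤ σ

variable {Δ} in
theorem mem_raysOf {σ : Δ.Cone} {ρ : Δ.Ray} : ρ ∈ Δ.raysOf σ ↔ ρ.1 ≤ σ := by
  simp [raysOf]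

variable [Module.Free ℤ N] [Module.Finite ℤ N]

theorem primitiveGenerator_ne_zero (ρ : Δ.Ray) : Δ.primitiveGenerator ρ ≠ 0 :=
  (Δ.exists_primitiveGenerator ρ).choose_spec.1

theorem primitiveGenerator_mem (ρ : Δ.Ray) : (1 : ℝ) ⊗ₜ[ℤ] Δ.primitiveGenerator ρ ∈ ρ.1.1 :=
  (Δ.exists_primitiveGenerator ρ).choose_spec.2.1

theorem exists_eq_nsmul_primitiveGenerator (ρ : Δ.Ray) {n : N} (hn : (1 : ℝ) ⊗ₜ[ℤ] n ∈ ρ.1.1) :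
    ∃ k : ℕ, n = k • Δ.primitiveGenerator ρ :=
  (Δ.exists_primitiveGenerator ρ).choose_spec.2.2 n hn

theorem ray_eq_hull (ρ : Δ.Ray) :
    ρ.1.1 = PointedCone.hull ℝ {(1 : ℝ) ⊗ₜ[ℤ] Δ.primitiveGenerator ρ} := by
  apply le_antisymm
  · obtain ⟨b, s, hs⟩ := Δ.smooth ρ.1.1 ρ.1.2
    have : ∀ i ∈ s, (1 : ℝ) ⊗ₜ[ℤ] b i ∈ ρ.1.1 := fun i hi => by
      rw [hs]; exact Submodule.subset_span ⟨i, hi, rfl⟩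
    conv_lhs => rw [hs]
    refine Submodule.span_le.2 ?_
    rintro _ ⟨i, hi, rfl⟩
    obtain ⟨k, hk⟩ := Δ.exists_eq_nsmul_primitiveGenerator ρ (this i hi)
    simp only [hk, TensorProduct.tmul_smul]
    rw [← Nat.cast_smul_eq_nsmul ℝ]
    exact PointedCone.smul_mem _ k.cast_nonneg (Submodule.subset_span rfl)
  · refine Submodule.span_le.2 ?_
    rintro _ rfl
    exact Δ.primitiveGenerator_mem ρ

theorem primitiveGenerator_injective : Function.Injective Δ.primitiveGenerator := by
  intro ρ ρ' h
  refine Subtype.ext (Subtype.ext ?_)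
  rw [ray_eq_hull, ray_eq_hull, h]

theorem primitiveGenerator_eq_of_mem (ρ : Δ.Ray)
    (b : Module.Basis (Fin (Module.finrank ℤ N)) ℤ N) (i : Fin (Module.finrank ℤ N))
    (hi : (1 : ℝ) ⊗ₜ[ℤ] b i ∈ ρ.1.1) : Δ.primitiveGenerator ρ = b i := by
  obtain ⟨k, hk⟩ := Δ.exists_eq_nsmul_primitiveGenerator ρ hi
  have h1 : (k : ℤ) * b.coord i (Δ.primitiveGenerator ρ) = 1 := by
    have := congrArg (b.coord i) hk
    simpa using this.symm
  have h2 : (k : ℤ) = 1 := Int.eq_one_of_mul_eq_one_right (by positivity) h1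
  have h3 : k = 1 := by exact_mod_cast h2
  rw [hk, h3, one_smul]

/-- The rays contained in a cone of the fan are spanned by the members of any basis adapted to
the cone. -/
theorem exists_basis_eq_primitiveGenerator {σ : Δ.Cone}
    {b : Module.Basis (Fin (Module.finrank ℤ N)) ℤ N} {s : Finset (Fin (Module.finrank ℤ N))}
    (hσ : σ.1 = PointedCone.hull ℝ ((fun i => (1 : ℝ) ⊗ₜ[ℤ] b i) '' s))
    {ρ : Δ.Ray} (h : ρ.1 ≤ σ) : ∃ i ∈ s, Δ.primitiveGenerator ρ = b i := by
  classical
  have hface := Δ.isFaceOf h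
  have hmem := Δ.primitiveGenerator_mem ρ
  have hmem' : (1 : ℝ) ⊗ₜ[ℤ] Δ.primitiveGenerator ρ ∈ σ.1 := h hmem
  rw [hσ, mem_hull_iff] at hmem'
  obtain ⟨c, h1, h2, h3⟩ := hmem'
  obtain ⟨i, hi⟩ : ∃ i, c i ≠ 0 := by
    by_contra! hc
    refine Δ.primitiveGenerator_ne_zero ρ (tmul_injective ?_)
    beta_reduce
    rw [h3, TensorProduct.tmul_zero]
    exact Finset.sum_eq_zero fun i _ => by rw [hc, zero_smul]
  have his : i ∈ s := by
    by_contra his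
    exact hi (h2 i his)
  refine ⟨i, his, Δ.primitiveGenerator_eq_of_mem ρ b i ?_⟩
  have hg : ∀ j ∈ s, (1 : ℝ) ⊗ₜ[ℤ] b j ∈ σ.1 := fun j hj => by
    rw [hσ]; exact Submodule.subset_span ⟨j, hj, rfl⟩
  have hrest : ∑ j ∈ Finset.univ.erase i, c j • ((1 : ℝ) ⊗ₜ[ℤ] b j) ∈ σ.1 := by
    refine Submodule.sum_mem _ fun j _ => ?_
    by_cases hj : j ∈ s
    · exact PointedCone.smul_mem _ (h1 j) (hg j hj)
    · rw [h2 j hj, zero_smul]; exact Submodule.zero_mem _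
  refine hface.mem_of_smul_add_mem (hg i his) hrest (lt_of_le_of_ne (h1 i) (Ne.symm hi)) ?_
  rw [Finset.add_sum_erase _ (fun j => c j • ((1 : ℝ) ⊗ₜ[ℤ] b j : RealSpace N))
    (Finset.mem_univ i), ← h3]
  exact hmem

/-- Each member of a basis adapted to a cone of the fan generates a ray of the fan. -/
theorem exists_ray {σ : Δ.Cone}
    {b : Module.Basis (Fin (Module.finrank ℤ N)) ℤ N} {s : Finset (Fin (Module.finrank ℤ N))}
    (hσ : σ.1 = PointedCone.hull ℝ ((fun i => (1 : ℝ) ⊗ₜ[ℤ] b i) '' s))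
    {i : Fin (Module.finrank ℤ N)} (hi : i ∈ s) :
    ∃ ρ : Δ.Ray, ρ.1 ≤ σ ∧ Δ.primitiveGenerator ρ = b i := by
  have hface := hull_singleton_isFaceOf b s hi
  rw [← hσ] at hface
  have hspan : Submodule.span ℝ
      ((PointedCone.hull ℝ {(1 : ℝ) ⊗ₜ[ℤ] b i} : PointedCone ℝ (RealSpace N)) :
        Set (RealSpace N)) = Submodule.span ℝ {(1 : ℝ) ⊗ₜ[ℤ] b i} := by
    apply le_antisymm
    · refine Submodule.span_le.2 fun v hv => ?_
      obtain ⟨a, rfl⟩ := Submodule.mem_span_singleton.1 hv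
      exact Submodule.smul_mem _ (a : ℝ) (Submodule.subset_span rfl)
    · exact Submodule.span_mono Submodule.subset_span
  have hne : (1 : ℝ) ⊗ₜ[ℤ] b i ≠ 0 := fun h0 =>
    b.ne_zero i (tmul_injective (N := N) (by simpa using h0))
  let ρ : Δ.Ray := ⟨⟨PointedCone.hull ℝ {(1 : ℝ) ⊗ₜ[ℤ] b i}, Δ.face_mem _ σ.2 _ hface⟩, by
    rw [hspan, finrank_span_singleton hne]⟩
  exact ⟨ρ, hface.le, Δ.primitiveGenerator_eq_of_mem ρ b i (Submodule.subset_span rfl)⟩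

theorem mem_iSup_rays (A : Finset Δ.Ray) (v : RealSpace N) :
    v ∈ ⨆ ρ ∈ A, ρ.1.1 ↔ ∃ c : Δ.Ray → ℝ, (∀ ρ, 0 ≤ c ρ) ∧
      v = ∑ ρ ∈ A, c ρ • ((1 : ℝ) ⊗ₜ[ℤ] Δ.primitiveGenerator ρ) := by
  classical
  constructor
  · intro hv
    obtain ⟨f, hf⟩ := (Submodule.mem_iSup_finset_iff_exists_sum _ _).1 hv
    have : ∀ ρ : Δ.Ray, ∃ a : ℝ, 0 ≤ a ∧
        (f ρ : RealSpace N) = a • ((1 : ℝ) ⊗ₜ[ℤ] Δ.primitiveGenerator ρ) := fun ρ => by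
      have h : (f ρ : RealSpace N) ∈ PointedCone.hull ℝ {(1 : ℝ) ⊗ₜ[ℤ] Δ.primitiveGenerator ρ} :=
        Δ.ray_eq_hull ρ ▸ (f ρ).2
      obtain ⟨a, ha⟩ := Submodule.mem_span_singleton.1 h
      exact ⟨a, a.2, ha.symm⟩
    choose c hc0 hc using this
    exact ⟨c, hc0, by rw [← hf]; exact Finset.sum_congr rfl fun ρ _ => hc ρ⟩
  · rintro ⟨c, h0, rfl⟩
    refine Submodule.sum_mem _ fun ρ hρ => PointedCone.smul_mem _ (h0 ρ) ?_
    exact Submodule.mem_iSup_of_mem ρ (Submodule.mem_iSup_of_mem hρ (Δ.primitiveGenerator_mem ρ))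

theorem cone_eq_iSup_rays (σ : Δ.Cone) : σ.1 = ⨆ ρ ∈ Δ.raysOf σ, ρ.1.1 := by
  apply le_antisymm
  · obtain ⟨b, s, hσ⟩ := Δ.smooth σ.1 σ.2
    conv_lhs => rw [hσ]
    refine Submodule.span_le.2 ?_
    rintro _ ⟨i, hi, rfl⟩
    obtain ⟨ρ, hρ, hb⟩ := Δ.exists_ray hσ hi
    refine Submodule.mem_iSup_of_mem ρ (Submodule.mem_iSup_of_mem (mem_raysOf.2 hρ) ?_)
    simp only [← hb]
    exact Δ.primitiveGenerator_mem ρ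
  · exact iSup₂_le fun ρ hρ => mem_raysOf.1 hρ

theorem mem_dualMonoid_iff (σ : Δ.Cone) (m : DualLattice N) :
    m ∈ dualMonoid σ.1 ↔ ∀ ρ : Δ.Ray, ρ.1 ≤ σ → 0 ≤ m (Δ.primitiveGenerator ρ) := by
  constructor
  · intro h ρ hρ
    have := h _ (hρ (Δ.primitiveGenerator_mem ρ))
    simpa [realPairing_tmul] using this
  · intro h v hv
    rw [cone_eq_iSup_rays, mem_iSup_rays] at hv
    obtain ⟨c, h0, rfl⟩ := hv
    rw [map_sum]
    refine Finset.sum_nonneg fun ρ hρ => ?_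
    rw [map_smul, realPairing_tmul, mul_one, smul_eq_mul]
    exact mul_nonneg (h0 ρ) (by exact_mod_cast h ρ (mem_raysOf.1 hρ))

theorem exists_dualVector (σ : Δ.Cone) : ∃ e : Δ.Ray → DualLattice N, ∀ ρ ρ' : Δ.Ray,
    ρ.1 ≤ σ → ρ'.1 ≤ σ →
      (ρ = ρ' → e ρ (Δ.primitiveGenerator ρ') = 1) ∧
      (ρ ≠ ρ' → e ρ (Δ.primitiveGenerator ρ') = 0) := by
  classical
  obtain ⟨b, s, hσ⟩ := Δ.smooth σ.1 σ.2
  have : ∀ ρ : Δ.Ray, ∃ i, ρ.1 ≤ σ → Δ.primitiveGenerator ρ = b i := fun ρ => by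
    by_cases h : ρ.1 ≤ σ
    · obtain ⟨i, -, hi⟩ := Δ.exists_basis_eq_primitiveGenerator hσ h
      exact ⟨i, fun _ => hi⟩
    · obtain ⟨b', s', hs'⟩ := Δ.smooth ρ.1.1 ρ.1.2
      obtain ⟨i, -, -⟩ := Δ.exists_basis_eq_primitiveGenerator hs' le_rfl
      exact ⟨i, fun h' => absurd h' h⟩
  choose i hi using this
  refine ⟨fun ρ => b.coord (i ρ), fun ρ ρ' hρ hρ' => ⟨?_, fun hne => ?_⟩⟩
  · rintro rfl
    simp [hi ρ hρ]
  · have : i ρ' ≠ i ρ := fun h =>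
      hne (Δ.primitiveGenerator_injective (by rw [hi ρ hρ, hi ρ' hρ', h]))
    simp [hi ρ' hρ', this]

/-- The member of the dual basis attached to the ray `ρ` of the cone `σ`: it takes the value `1`
on `n(ρ)` and `0` on the primitive generators of the other rays of `σ`. -/
noncomputable def dualVector (σ : Δ.Cone) (ρ : Δ.Ray) : DualLattice N :=
  (Δ.exists_dualVector σ).choose ρ

theorem dualVector_self {σ : Δ.Cone} {ρ : Δ.Ray} (h : ρ.1 ≤ σ) :
    Δ.dualVector σ ρ (Δ.primitiveGenerator ρ) = 1 :=
  ((Δ.exists_dualVector σ).choose_spec ρ ρ h h).1 rfl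

theorem dualVector_of_ne {σ : Δ.Cone} {ρ ρ' : Δ.Ray} (h : ρ.1 ≤ σ) (h' : ρ'.1 ≤ σ)
    (hne : ρ ≠ ρ') : Δ.dualVector σ ρ (Δ.primitiveGenerator ρ') = 0 :=
  ((Δ.exists_dualVector σ).choose_spec ρ ρ' h h').2 hne

theorem dualVector_mem {σ : Δ.Cone} {ρ : Δ.Ray} (h : ρ.1 ≤ σ) :
    Δ.dualVector σ ρ ∈ dualMonoid σ.1 := by
  rw [mem_dualMonoid_iff]
  intro ρ' h'
  by_cases hne : ρ = ρ'
  · subst hne; rw [Δ.dualVector_self h]; exact zero_le_one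
  · rw [Δ.dualVector_of_ne h h' hne]

open Classical in
/-- Any set of rays of a cone `σ` spans a face of `σ`, cut out by the sum of the dual vectors of
the remaining rays. -/
theorem supports_iSup_rays (σ : Δ.Cone) {A : Finset Δ.Ray} (hA : A ⊆ Δ.raysOf σ) :
    Supports (∑ ρ ∈ Δ.raysOf σ \ A, Δ.dualVector σ ρ) σ.1 (⨆ ρ ∈ A, ρ.1.1) := by
  have hpair : ∀ ρ' ∈ Δ.raysOf σ, (∑ ρ ∈ Δ.raysOf σ \ A, Δ.dualVector σ ρ)
      (Δ.primitiveGenerator ρ') = if ρ' ∈ Δ.raysOf σ \ A then 1 else 0 := by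
    intro ρ' hρ'
    rw [LinearMap.sum_apply]
    have : ∀ ρ ∈ Δ.raysOf σ \ A, Δ.dualVector σ ρ (Δ.primitiveGenerator ρ') =
        if ρ' = ρ then 1 else 0 := by
      intro ρ hρ
      have h1 := mem_raysOf.1 (Finset.mem_sdiff.1 hρ).1
      split_ifs with h
      · subst h; exact Δ.dualVector_self h1
      · exact Δ.dualVector_of_ne h1 (mem_raysOf.1 hρ') (Ne.symm h)
    rw [Finset.sum_congr rfl this, Finset.sum_ite_eq]
  intro v hv
  rw [cone_eq_iSup_rays, mem_iSup_rays] at hv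
  obtain ⟨c, h0, rfl⟩ := hv
  have key : ∀ B ⊆ Δ.raysOf σ, ∀ c : Δ.Ray → ℝ,
      realPairing (∑ ρ ∈ Δ.raysOf σ \ A, Δ.dualVector σ ρ)
      (∑ ρ ∈ B, c ρ • ((1 : ℝ) ⊗ₜ[ℤ] Δ.primitiveGenerator ρ)) = ∑ ρ ∈ B \ A, c ρ := by
    intro B hB c
    rw [map_sum]
    have : ∀ ρ ∈ B, realPairing (∑ ρ ∈ Δ.raysOf σ \ A, Δ.dualVector σ ρ)
        (c ρ • ((1 : ℝ) ⊗ₜ[ℤ] Δ.primitiveGenerator ρ)) = if ρ ∈ A then 0 else c ρ := by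
      intro ρ hρ
      rw [map_smul, realPairing_tmul, hpair ρ (hB hρ)]
      by_cases h : ρ ∈ A <;> simp [h, hB hρ]
    rw [Finset.sum_congr rfl this, ← Finset.filter_notMem_eq_sdiff, Finset.sum_filter]
    exact Finset.sum_congr rfl fun ρ _ => by by_cases h : ρ ∈ A <;> simp [h]
  refine ⟨?_, fun h => ?_, fun h => ?_⟩
  · rw [key _ subset_rfl]
    exact Finset.sum_nonneg fun ρ _ => h0 ρ
  · rw [key _ subset_rfl, Finset.sum_eq_zero_iff_of_nonneg fun ρ _ => h0 ρ] at h
    rw [mem_iSup_rays]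
    refine ⟨c, h0, (Finset.sum_subset hA fun ρ hρ hρA => ?_).symm⟩
    rw [h ρ (Finset.mem_sdiff.2 ⟨hρ, hρA⟩), zero_smul]
  · obtain ⟨d, -, hd⟩ := (Δ.mem_iSup_rays A _).1 h
    rw [hd, key A hA]
    simp

theorem iSup_rays_mem (σ : Δ.Cone) {A : Finset Δ.Ray} (hA : A ⊆ Δ.raysOf σ) :
    (⨆ ρ ∈ A, ρ.1.1) ∈ Δ.cones := by
  classical
  exact Δ.face_mem _ σ.2 _ ((Δ.supports_iSup_rays σ hA).isFaceOf
    (iSup₂_le fun ρ hρ => mem_raysOf.1 (hA hρ)))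

theorem ray_not_le_zeroCone (ρ : Δ.Ray) : ¬ ρ.1 ≤ Δ.zeroCone := fun h => by
  have h1 : (1 : ℝ) ⊗ₜ[ℤ] Δ.primitiveGenerator ρ = 0 :=
    (Submodule.mem_bot _).1 (h (Δ.primitiveGenerator_mem ρ))
  exact Δ.primitiveGenerator_ne_zero ρ (tmul_injective (by simpa using h1))

/-- A cone contained in a ray is zero unless it is the whole ray. -/
theorem le_zeroCone_of_le_ray {τ : Δ.Cone} {ρ : Δ.Ray} (h : τ ≤ ρ.1) (hne : ¬ ρ.1 ≤ τ) :
    τ.1 = ⊥ := by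
  rw [eq_bot_iff]
  intro v hv
  have hv' : v ∈ ρ.1.1 := h hv
  rw [ray_eq_hull] at hv'
  obtain ⟨a, rfl⟩ := Submodule.mem_span_singleton.1 hv'
  rcases eq_or_ne a 0 with rfl | ha
  · simp
  · refine absurd ?_ hne
    change ρ.1.1 ≤ τ.1
    rw [ray_eq_hull]
    refine Submodule.span_le.2 ?_
    rintro _ rfl
    have h3 := PointedCone.smul_mem τ.1 (inv_nonneg.2 a.2) hv
    have h4 : a • ((1 : ℝ) ⊗ₜ[ℤ] Δ.primitiveGenerator ρ) =
      (a : ℝ) • ((1 : ℝ) ⊗ₜ[ℤ] Δ.primitiveGenerator ρ) := rfl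
    rw [h4] at h3
    rw [smul_smul, inv_mul_cancel₀ (fun h => ha (Subtype.ext h)), one_smul] at h3
    exact h3

end SmoothFan

/-! ### Monomials on an affine chart -/

section Monomials

variable {N : Type} [AddCommGroup N]

theorem monomial_add {σ : PointedCone ℝ (RealSpace N)} (m m' : dualMonoid σ) :
    monomial σ (m + m') = monomial σ m * monomial σ m' := by
  rw [monomial, monomial, monomial, AddMonoidAlgebra.single_mul_single, one_mul]

theorem monomial_zero {σ : PointedCone ℝ (RealSpace N)} : monomial σ 0 = 1 := rfl

theorem chartRingMap_monomial {σ τ : PointedCone ℝ (RealSpace N)} (h : τ ≤ σ)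
    (m : dualMonoid σ) :
    chartRingMap h (monomial σ m) = monomial τ ⟨m.1, dualMonoid_anti h m.2⟩ :=
  chartRingMap_single h m 1

theorem ringHom_ext {σ : PointedCone ℝ (RealSpace N)} {R : Type*} [CommRing R]
    {f g : ChartRing σ →+* R}
    (h₁ : f.comp (algebraMap ℂ (ChartRing σ)) = g.comp (algebraMap ℂ (ChartRing σ)))
    (h₂ : ∀ m, f (monomial σ m) = g (monomial σ m)) : f = g := by
  refine AddMonoidAlgebra.ringHom_ext (fun r => ?_) h₂
  exact congrArg (fun φ : ℂ →+* R => φ r) h₁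

theorem single_mem_span_monomial {σ : PointedCone ℝ (RealSpace N)} {m m' : dualMonoid σ}
    (h : m'.1 - m.1 ∈ dualMonoid σ) (r : ℂ) :
    (AddMonoidAlgebra.single m' r : ChartRing σ) ∈ Ideal.span {monomial σ m} := by
  refine Ideal.mem_span_singleton.2 ⟨AddMonoidAlgebra.single ⟨_, h⟩ r, ?_⟩
  rw [monomial, AddMonoidAlgebra.single_mul_single, one_mul]
  congr 1
  ext1
  simp

instance [Module.Free ℤ N] : IsDomain (AddMonoidAlgebra ℂ (DualLattice N)) := by
  let b := Module.Free.chooseBasis ℤ N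
  let ev : DualLattice N →ₙ+ (Module.Free.ChooseBasisIndex ℤ N → ℤ) :=
    { toFun := fun m i => m (b i), map_add' := fun _ _ => rfl }
  have : UniqueSums (DualLattice N) :=
    UniqueSums.of_injective_addHom ev (fun m m' h => b.ext fun i => congrFun h i) inferInstance
  have : NoZeroDivisors (AddMonoidAlgebra ℂ (DualLattice N)) := inferInstance
  exact NoZeroDivisors.to_isDomain _

/-- Setting to zero the monomials that are not orthogonal to `n`: for `n` in the cone `σ`,
the homomorphism `ℂ[M ∩ σ^∨] → ℂ[M]` that fixes `e(m)` if `⟨m, n⟩ = 0` and kills it otherwise. -/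
noncomputable def restrictOrth (σ : PointedCone ℝ (RealSpace N)) (n : N)
    (hn : (1 : ℝ) ⊗ₜ[ℤ] n ∈ σ) : ChartRing σ →ₐ[ℂ] AddMonoidAlgebra ℂ (DualLattice N) :=
  AddMonoidAlgebra.lift ℂ _ (dualMonoid σ)
    { toFun := fun m => if m.toAdd.1 n = 0 then AddMonoidAlgebra.single m.toAdd.1 1 else 0
      map_one' := by simp [AddMonoidAlgebra.one_def]
      map_mul' := fun m m' => by
        have hpos : ∀ m : dualMonoid σ, 0 ≤ m.1 n := fun m => by
          have := m.2 _ hn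
          simpa [realPairing_tmul] using this
        have h1 := hpos m.toAdd
        have h2 := hpos m'.toAdd
        simp only [toAdd_mul, AddSubmonoid.coe_add, LinearMap.add_apply]
        by_cases h : m.toAdd.1 n = 0
        · by_cases h' : m'.toAdd.1 n = 0
          · simp [h, h', AddMonoidAlgebra.single_mul_single]
          · simp [h, h']
        · have : m.toAdd.1 n + m'.toAdd.1 n ≠ 0 := by omega
          simp [h, this] }

theorem restrictOrth_single {σ : PointedCone ℝ (RealSpace N)} {n : N}
    (hn : (1 : ℝ) ⊗ₜ[ℤ] n ∈ σ) (m : dualMonoid σ) (r : ℂ) :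
    restrictOrth σ n hn (AddMonoidAlgebra.single m r) =
      if m.1 n = 0 then AddMonoidAlgebra.single m.1 r else 0 := by
  rw [restrictOrth, AddMonoidAlgebra.lift_single]
  by_cases h : m.1 n = 0 <;> simp [h]

end Monomials

namespace SmoothFan

variable {N : Type} [AddCommGroup N] [Module.Free ℤ N] [Module.Finite ℤ N] (Δ : SmoothFan N)

/-- The local equation `e(m_ρ)` of the divisor `V(ρ)` on the chart `U_σ`, for a ray `ρ` of `σ`. -/
noncomputable def rayEquation {σ : Δ.Cone} {ρ : Δ.Ray} (h : ρ.1 ≤ σ) : ChartRing σ.1 :=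
  monomial σ.1 ⟨Δ.dualVector σ ρ, Δ.dualVector_mem h⟩

theorem sub_dualVector_mem {σ : Δ.Cone} {ρ : Δ.Ray} (h : ρ.1 ≤ σ) (m : dualMonoid σ.1)
    (hm : m.1 (Δ.primitiveGenerator ρ) ≠ 0) : m.1 - Δ.dualVector σ ρ ∈ dualMonoid σ.1 := by
  have h0 := (Δ.mem_dualMonoid_iff σ m.1).1 m.2
  rw [mem_dualMonoid_iff]
  intro ρ' h'
  rw [LinearMap.sub_apply]
  by_cases hne : ρ = ρ'
  · subst hne
    have := h0 ρ h
    rw [Δ.dualVector_self h]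
    omega
  · rw [Δ.dualVector_of_ne h h' hne, sub_zero]
    exact h0 ρ' h'

/-- The ideal of `e(m_ρ)` is spanned by the monomials `e(m)` with `⟨m, n(ρ)⟩ ≠ 0`, because each of
these is divisible by `e(m_ρ)`. The quotient embeds into `ℂ[M]`, so that the ideal is prime. -/
theorem ker_restrictOrth {σ : Δ.Cone} {ρ : Δ.Ray} (h : ρ.1 ≤ σ) :
    RingHom.ker (restrictOrth σ.1 (Δ.primitiveGenerator ρ) (h (Δ.primitiveGenerator_mem ρ))) =
      Ideal.span {Δ.rayEquation h} := by
  set φ := restrictOrth σ.1 (Δ.primitiveGenerator ρ) (h (Δ.primitiveGenerator_mem ρ)) with hφ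
  have hle : Ideal.span {Δ.rayEquation h} ≤ RingHom.ker φ := by
    rw [Ideal.span_singleton_le_iff_mem, RingHom.mem_ker, rayEquation, monomial, hφ,
      restrictOrth_single, if_neg]
    rw [Δ.dualVector_self h]
    exact one_ne_zero
  refine le_antisymm (fun x hx => ?_) hle
  -- The monomials orthogonal to `n(ρ)` span a complement of the ideal, on which `φ` is injective.
  let F : AddSubmonoid (DualLattice N) := dualMonoid σ.1 ⊓
    (AddMonoidHom.mker ((LinearMap.applyₗ (Δ.primitiveGenerator ρ)).toAddMonoidHom :
      DualLattice N →+ ℤ))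
  let ι : AddMonoidAlgebra ℂ F →+* ChartRing σ.1 :=
    AddMonoidAlgebra.mapDomainRingHom ℂ (AddSubmonoid.inclusion (inf_le_left : F ≤ _))
  have hι : ∀ (m : F) (r : ℂ), ι (AddMonoidAlgebra.single m r) =
      AddMonoidAlgebra.single ⟨m.1, m.2.1⟩ r := fun m r => by simp [ι]; rfl
  have hcomp : (φ : ChartRing σ.1 →+* _).comp ι =
      AddMonoidAlgebra.mapDomainRingHom ℂ F.subtype := by
    have key : ∀ (m : F) (r : ℂ), φ (ι (AddMonoidAlgebra.single m r)) =
        AddMonoidAlgebra.single m.1 r := fun m r => by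
      rw [hι, hφ, restrictOrth_single, if_pos]
      exact m.2.2
    refine AddMonoidAlgebra.ringHom_ext (fun r => ?_) fun m => ?_
    · exact (key _ _).trans (by simp)
    · exact (key _ _).trans (by simp)
  obtain ⟨y, hy⟩ : ∃ y, x - ι y ∈ Ideal.span {Δ.rayEquation h} := by
    clear hx hcomp hle hφ
    clear_value φ
    induction x using AddMonoidAlgebra.induction_linear with
    | zero => exact ⟨0, by rw [map_zero, sub_zero]; exact Ideal.zero_mem _⟩
    | add x x' hx hx' =>
      obtain ⟨y, hy⟩ := hx
      obtain ⟨y', hy'⟩ := hx'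
      refine ⟨y + y', ?_⟩
      rw [RingHom.map_add, add_sub_add_comm]
      exact Ideal.add_mem _ hy hy'
    | single m r =>
      by_cases hm : m.1 (Δ.primitiveGenerator ρ) = 0
      · refine ⟨AddMonoidAlgebra.single ⟨m.1, m.2, hm⟩ r, ?_⟩
        rw [hι, sub_self]
        exact Ideal.zero_mem _
      · refine ⟨0, ?_⟩
        rw [RingHom.map_zero, sub_zero]
        exact single_mem_span_monomial (m := ⟨_, Δ.dualVector_mem h⟩)
          (Δ.sub_dualVector_mem h m hm) r
  have h1 : φ (ι y) = 0 := by
    have h2 : φ (x - ι y) = 0 := (RingHom.mem_ker (f := φ)).1 (hle hy)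
    have h3 : φ x = 0 := (RingHom.mem_ker (f := φ)).1 hx
    rwa [map_sub, h3, zero_sub, neg_eq_zero] at h2
  have h2 : AddMonoidAlgebra.mapDomainRingHom ℂ F.subtype y = 0 := by
    rw [← hcomp]; exact h1
  have hinj : Function.Injective (AddMonoidAlgebra.mapDomainRingHom ℂ F.subtype) :=
    AddMonoidAlgebra.mapDomain_injective Subtype.val_injective
  have h3 : y = 0 := (map_eq_zero_iff _ hinj).1 h2
  rwa [h3, map_zero, sub_zero] at hy

theorem rayEquation_isPrime {σ : Δ.Cone} {ρ : Δ.Ray} (h : ρ.1 ≤ σ) :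
    (Ideal.span {Δ.rayEquation h}).IsPrime := by
  rw [← Δ.ker_restrictOrth h]
  exact RingHom.ker_isPrime _

theorem monomial_mem_span_rayEquation {σ : Δ.Cone} {ρ : Δ.Ray} (h : ρ.1 ≤ σ)
    (m : dualMonoid σ.1) :
    monomial σ.1 m ∈ Ideal.span {Δ.rayEquation h} ↔ m.1 (Δ.primitiveGenerator ρ) ≠ 0 := by
  rw [← Δ.ker_restrictOrth h, RingHom.mem_ker, monomial, restrictOrth_single]
  by_cases h : m.1 (Δ.primitiveGenerator ρ) = 0
  · simp [h]
  · simp [h]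

/-- If the local equations of the rays of `σ` outside `A` do not vanish at a point of `U_σ`, then
the point lies in the smaller chart given by the rays in `A`. -/
theorem mem_range_chartMap_iSup {σ : Δ.Cone} {A : Finset Δ.Ray} (hA : A ⊆ Δ.raysOf σ)
    (x : chart σ.1)
    (hx : ∀ (ρ : Δ.Ray) (h : ρ.1 ≤ σ), ρ ∉ A →
      Δ.rayEquation h ∉ (show PrimeSpectrum (ChartRing σ.1) from x).asIdeal) :
    x ∈ Set.range (chartMap (σ := σ.1) (τ := ⨆ ρ ∈ A, ρ.1.1)
      (iSup₂_le fun _ hρ => mem_raysOf.1 (hA hρ))) := by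
  classical
  have hsup := Δ.supports_iSup_rays σ hA
  rw [range_chartMap _ (Δ.smooth _ σ.2) hsup]
  change monomial σ.1 ⟨_, hsup.mem⟩ ∉ (show PrimeSpectrum (ChartRing σ.1) from x).asIdeal
  -- The supporting monomial is the product of the local equations of the rays outside `A`.
  have key : ∀ (B : Finset Δ.Ray), B ⊆ Δ.raysOf σ \ A →
      ∀ (hB : ∑ ρ ∈ B, Δ.dualVector σ ρ ∈ dualMonoid σ.1),
      monomial σ.1 ⟨_, hB⟩ ∉ (show PrimeSpectrum (ChartRing σ.1) from x).asIdeal := by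
    intro B
    induction B using Finset.induction_on with
    | empty =>
      intro _ hB hmem
      have h1 : (⟨∑ ρ ∈ (∅ : Finset Δ.Ray), Δ.dualVector σ ρ, hB⟩ : dualMonoid σ.1) = 0 := by
        ext1; simp
      rw [h1, monomial_zero] at hmem
      exact (show PrimeSpectrum (ChartRing σ.1) from x).isPrime.ne_top
        ((Ideal.eq_top_iff_one _).2 hmem)
    | insert ρ B hρ ih =>
      intro hB hB' hmem
      obtain ⟨h1, h2⟩ := Finset.insert_subset_iff.1 hB
      have h3 := mem_raysOf.1 (Finset.mem_sdiff.1 h1).1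
      have h4 : ∑ ρ ∈ B, Δ.dualVector σ ρ ∈ dualMonoid σ.1 :=
        sum_mem fun _ hρ => Δ.dualVector_mem (mem_raysOf.1 (Finset.mem_sdiff.1 (h2 hρ)).1)
      have h5 : (⟨_, hB'⟩ : dualMonoid σ.1) = ⟨_, Δ.dualVector_mem h3⟩ + ⟨_, h4⟩ := by
        ext1
        simp [Finset.sum_insert hρ]
      rw [h5, monomial_add] at hmem
      rcases (show PrimeSpectrum (ChartRing σ.1) from x).isPrime.mem_or_mem hmem with h | h
      · exact hx ρ h3 (Finset.mem_sdiff.1 h1).2 h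
      · exact ih h2 h4 h
  exact key _ subset_rfl _

end SmoothFan

/-! ### Stalks of vanishing ideals -/

namespace NormalVariety

variable {X : Scheme.{0}}

theorem map_germ_ideal_affineBasicOpen (I : X.IdealSheafData) (U : X.affineOpens) (f : Γ(X, U))
    (x : X) (hx : x ∈ X.basicOpen f) :
    (I.ideal (X.affineBasicOpen f)).map (X.presheaf.germ (X.basicOpen f) x hx).hom =
      (I.ideal U).map (X.presheaf.germ U.1 x (X.basicOpen_le f hx)).hom := by
  rw [← I.map_ideal_basicOpen]
  refine (Ideal.map_map _ _).trans ?_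
  exact congrArg (fun φ : Γ(X, U.1) ⟶ X.presheaf.stalk x => (I.ideal U).map φ.hom)
    (X.presheaf.germ_res (homOfLE (X.basicOpen_le f)) x hx)

/-- The stalk of an ideal sheaf can be computed on any affine neighbourhood. -/
theorem idealStalk_eq_map (I : X.IdealSheafData) (U : X.affineOpens) (x : X) (hx : x ∈ U.1) :
    idealStalk I x = (I.ideal U).map (X.presheaf.germ U.1 x hx).hom := by
  refine le_antisymm (iSup₂_le fun V hV => ?_) (le_iSup₂_of_le U hx le_rfl)
  obtain ⟨f, g, hfg, hf⟩ := exists_basicOpen_le_affine_inter U.2 V.2 x ⟨hx, hV⟩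
  have hg : x ∈ X.basicOpen g := hfg ▸ hf
  rw [← map_germ_ideal_affineBasicOpen I U f x hf, ← map_germ_ideal_affineBasicOpen I V g x hg]
  have key : ∀ (W W' : X.affineOpens) (h : x ∈ W.1) (h' : x ∈ W'.1), W = W' →
      (I.ideal W).map (X.presheaf.germ W.1 x h).hom =
      (I.ideal W').map (X.presheaf.germ W'.1 x h').hom := by
    rintro W _ h h' rfl
    rfl
  exact (key (X.affineBasicOpen g) (X.affineBasicOpen f) hg hf (Subtype.ext hfg.symm)).le

theorem mem_vanishingIdeal_iff (Z : Closeds X) (U : X.affineOpens) (s : Γ(X, U.1)) :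
    s ∈ (Scheme.IdealSheafData.vanishingIdeal Z).ideal U ↔
      ∀ x ∈ U.1, x ∈ Z → x ∉ X.basicOpen s := by
  rw [Scheme.IdealSheafData.vanishingIdeal_ideal, PrimeSpectrum.mem_vanishingIdeal]
  have key : ∀ p : Spec Γ(X, U.1), U.2.fromSpec p ∈ X.basicOpen s ↔
      s ∉ (show PrimeSpectrum Γ(X, U.1) from p).asIdeal := fun p => by
    have := U.2.fromSpec_preimage_basicOpen s
    exact (SetLike.ext_iff.1 this p)
  constructor
  · intro h x hx hxZ hxs
    rw [← SetLike.mem_coe, ← U.2.range_fromSpec] at hx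
    obtain ⟨p, rfl⟩ := hx
    exact (key p).1 hxs (h p hxZ)
  · intro h p hp
    by_contra hps
    have hpU : U.2.fromSpec p ∈ U.1 := by
      rw [← SetLike.mem_coe, ← U.2.range_fromSpec]
      exact ⟨p, rfl⟩
    exact h _ hpU hp ((key p).2 hps)

theorem idealStalk_eq_top_of_notMem {Z : Closeds X} {x : X} (hx : x ∉ Z) :
    idealStalk (Scheme.IdealSheafData.vanishingIdeal Z) x = ⊤ := by
  obtain ⟨_, ⟨U, hU, rfl⟩, hxU, -⟩ :=
    X.isBasis_affineOpens.exists_subset_of_mem_open (Set.mem_univ x) isOpen_univ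
  let V : X.Opens := ⟨(Z : Set X)ᶜ, Z.isClosed.isOpen_compl⟩
  obtain ⟨f, hfV, hxf⟩ := IsAffineOpen.exists_basicOpen_le hU (V := V) ⟨x, hx⟩ hxU
  rw [idealStalk_eq_map _ ⟨U, hU⟩ x hxU, Ideal.eq_top_iff_one]
  have h1 : f ∈ (Scheme.IdealSheafData.vanishingIdeal Z).ideal ⟨U, hU⟩ := by
    rw [mem_vanishingIdeal_iff]
    exact fun y _ hyZ hyf => hfV hyf hyZ
  have h2 := (X.mem_basicOpen f x hxU).1 hxf
  exact (Ideal.eq_top_iff_one _).1 (Ideal.eq_top_of_isUnit_mem _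
    (Ideal.mem_map_of_mem (X.presheaf.germ U x hxU).hom h1) h2)

end NormalVariety

/-! ### The charts of a toric variety -/

namespace SmoothFan

section Charts

variable {N : Type} [AddCommGroup N] (Δ : SmoothFan N)

/-- The chart `U_σ` as an open subset of the toric variety. -/
noncomputable def chartOpen (σ : Δ.Cone) : Δ.toricVariety.Opens := Δ.chartι σ ''ᵁ ⊤

/-- A function on the affine chart `U_σ` as a section over `U_σ` of the structure sheaf. -/
noncomputable def chartSection (σ : Δ.Cone) : ChartRing σ.1 →+* Γ(Δ.toricVariety, Δ.chartOpen σ) :=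
  ((Scheme.ΓSpecIso (CommRingCat.of (ChartRing σ.1))).inv ≫ ((Δ.chartι σ).appIso ⊤).inv).hom

theorem isAffineOpen_chartOpen (σ : Δ.Cone) : IsAffineOpen (Δ.chartOpen σ) :=
  (isAffineOpen_top _).image_of_isOpenImmersion _

theorem mem_chartOpen {σ : Δ.Cone} {z : Δ.toricVariety} :
    z ∈ Δ.chartOpen σ ↔ ∃ x, Δ.chartι σ x = z := by
  change z ∈ (Δ.chartι σ '' Set.univ) ↔ _
  simp

theorem chartι_mem (σ : Δ.Cone) (x : chart σ.1) : Δ.chartι σ x ∈ Δ.chartOpen σ :=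
  Δ.mem_chartOpen.2 ⟨x, rfl⟩

theorem chartι_injective (σ : Δ.Cone) : Function.Injective (Δ.chartι σ) :=
  (Δ.chartι σ).isOpenEmbedding.injective

theorem chartMap_chartι {τ σ : Δ.Cone} (h : τ ≤ σ) :
    chartMap (σ := σ.1) (τ := τ.1) h ≫ Δ.chartι σ = Δ.chartι τ :=
  colimit.w Δ.charts (homOfLE h)

theorem chartι_chartMap_apply {τ σ : Δ.Cone} (h : τ ≤ σ) (x : chart τ.1) :
    Δ.chartι σ (chartMap (σ := σ.1) (τ := τ.1) h x) = Δ.chartι τ x := by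
  rw [← Δ.chartMap_chartι h, Scheme.Hom.comp_apply]

theorem chartι_toSpecℂ (σ : Δ.Cone) : Δ.chartι σ ≫ Δ.toSpecℂ =
    Spec.map (CommRingCat.ofHom (algebraMap ℂ (ChartRing σ.1))) :=
  colimit.ι_desc _ _

theorem exists_mem_chartOpen (z : Δ.toricVariety) : ∃ σ : Δ.Cone, z ∈ Δ.chartOpen σ := by
  obtain ⟨σ, x, hx⟩ := Scheme.IsLocallyDirected.ι_jointly_surjective Δ.charts z
  exact ⟨σ, Δ.mem_chartOpen.2 ⟨x, hx⟩⟩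

theorem chartOpen_mono {τ σ : Δ.Cone} (h : τ ≤ σ) : Δ.chartOpen τ ≤ Δ.chartOpen σ := by
  intro z hz
  obtain ⟨x, rfl⟩ := Δ.mem_chartOpen.1 hz
  rw [← Δ.chartι_chartMap_apply h]
  exact Δ.chartι_mem _ _

/-- The intersection of two charts is covered by the charts of common faces. -/
theorem exists_le_of_chartι_eq {σ σ' : Δ.Cone} {x : chart σ.1} {x' : chart σ'.1}
    (h : Δ.chartι σ x = Δ.chartι σ' x') :
    ∃ (τ : Δ.Cone) (l : τ ≤ σ) (_ : τ ≤ σ') (y : chart τ.1),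
      chartMap (σ := σ.1) (τ := τ.1) l y = x := by
  obtain ⟨τ, f, g, y, h1, -⟩ := (Scheme.IsLocallyDirected.ι_eq_ι_iff Δ.charts).1 h
  exact ⟨τ, leOfHom f, leOfHom g, y, h1⟩

theorem chartι_mem_chartOpen {τ σ : Δ.Cone} (h : τ ≤ σ) {x : chart σ.1}
    (hx : x ∈ Set.range (chartMap (σ := σ.1) (τ := τ.1) h)) : Δ.chartι σ x ∈ Δ.chartOpen τ := by
  obtain ⟨w, rfl⟩ := hx
  rw [Δ.chartι_chartMap_apply h]
  exact Δ.chartι_mem τ w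

theorem mem_range_chartMap_of_eq {τ σ : Δ.Cone} (h : τ ≤ σ) {x : chart σ.1}
    {υ : PointedCone ℝ (RealSpace N)} {hυ : υ ≤ σ.1} (heq : υ = τ.1)
    (hx : x ∈ Set.range (chartMap (σ := σ.1) (τ := υ) hυ)) :
    x ∈ Set.range (chartMap (σ := σ.1) (τ := τ.1) h) := by
  subst heq
  exact hx

theorem chartι_mem_basicOpen {σ : Δ.Cone} (x : chart σ.1) (a : ChartRing σ.1) :
    Δ.chartι σ x ∈ Δ.toricVariety.basicOpen (Δ.chartSection σ a) ↔
      a ∉ (show PrimeSpectrum (ChartRing σ.1) from x).asIdeal := by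
  have h1 : Δ.toricVariety.basicOpen (Δ.chartSection σ a) =
      Δ.chartι σ ''ᵁ (chart σ.1).basicOpen
        ((Scheme.ΓSpecIso (CommRingCat.of (ChartRing σ.1))).inv a) :=
    (Scheme.image_basicOpen (Δ.chartι σ) _).symm
  rw [h1, basicOpen_eq_of_affine]
  constructor
  · rintro ⟨y, hy, hyx⟩
    rw [← Δ.chartι_injective σ hyx]
    exact hy
  · exact fun h => ⟨x, h, rfl⟩

theorem chartSection_bijective (σ : Δ.Cone) : Function.Bijective (Δ.chartSection σ) :=
  ConcreteCategory.bijective_of_isIso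
    ((Scheme.ΓSpecIso (CommRingCat.of (ChartRing σ.1))).inv ≫ ((Δ.chartι σ).appIso ⊤).inv)

theorem le_preimage_chartOpen (σ : Δ.Cone) : ⊤ ≤ Δ.chartι σ ⁻¹ᵁ Δ.chartOpen σ :=
  ((Δ.chartι σ).preimage_image_eq ⊤).ge

theorem chartSection_appLE (σ : Δ.Cone) (a : ChartRing σ.1) :
    (Δ.chartι σ).appLE (Δ.chartOpen σ) ⊤ (Δ.le_preimage_chartOpen σ)
      (Δ.chartSection σ a) = (Scheme.ΓSpecIso (CommRingCat.of (ChartRing σ.1))).inv a := by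
  have h : ((Δ.chartι σ).appIso ⊤).inv ≫ (Δ.chartι σ).appLE (Δ.chartOpen σ) ⊤
      (Δ.le_preimage_chartOpen σ) = 𝟙 _ :=
    (Scheme.Hom.appIso_inv_appLE (Δ.chartι σ) (Δ.le_preimage_chartOpen σ)).trans
      ((chart σ.1).presheaf.map_id _)
  exact congrArg (fun f => f.hom ((Scheme.ΓSpecIso (CommRingCat.of (ChartRing σ.1))).inv a)) h

theorem map_chartSection {τ σ : Δ.Cone} (h : τ ≤ σ) (a : ChartRing σ.1) :
    Δ.toricVariety.presheaf.map (homOfLE (Δ.chartOpen_mono h)).op (Δ.chartSection σ a) =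
      Δ.chartSection τ (chartRingMap (σ := σ.1) (τ := τ.1) h a) := by
  have hinj : Function.Injective ((Δ.chartι τ).appIso ⊤).hom :=
    (ConcreteCategory.bijective_of_isIso ((Δ.chartι τ).appIso ⊤).hom).1
  apply hinj
  rw [Scheme.Hom.appIso_hom']
  have h1 := Δ.chartSection_appLE τ (chartRingMap (σ := σ.1) (τ := τ.1) h a)
  refine Eq.trans ?_ h1.symm
  have h2 := Δ.chartSection_appLE σ a
  have h3 : (Scheme.ΓSpecIso (CommRingCat.of (ChartRing τ.1))).inv
      (chartRingMap (σ := σ.1) (τ := τ.1) h a) =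
      (chartMap (σ := σ.1) (τ := τ.1) h).appTop
        ((Scheme.ΓSpecIso (CommRingCat.of (ChartRing σ.1))).inv a) :=
    congrArg (fun f => f.hom a) (Scheme.ΓSpecIso_inv_naturality
      (CommRingCat.ofHom (chartRingMap (σ := σ.1) (τ := τ.1) h)))
  rw [h3, ← h2]
  have h4 : Δ.toricVariety.presheaf.map (homOfLE (Δ.chartOpen_mono h)).op ≫
      (Δ.chartι τ).appLE (Δ.chartOpen τ) ⊤ (Δ.le_preimage_chartOpen τ) =
      (Δ.chartι σ).appLE (Δ.chartOpen σ) ⊤ (Δ.le_preimage_chartOpen σ) ≫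
        (chartMap (σ := σ.1) (τ := τ.1) h).appTop := by
    have key : ∀ (k : chart τ.1 ⟶ Δ.toricVariety) (e : ⊤ ≤ k ⁻¹ᵁ Δ.chartOpen σ),
        chartMap (σ := σ.1) (τ := τ.1) h ≫ Δ.chartι σ = k →
        k.appLE (Δ.chartOpen σ) ⊤ e = (Δ.chartι σ).appLE (Δ.chartOpen σ) ⊤
          (Δ.le_preimage_chartOpen σ) ≫ (chartMap (σ := σ.1) (τ := τ.1) h).appTop := by
      rintro _ e rfl
      exact (Scheme.Hom.appLE_comp_appLE _ _ _ ⊤ ⊤ _ le_rfl).symm.trans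
        (congrArg (_ ≫ ·) (Scheme.Hom.appLE_eq_app _))
    exact (Scheme.Hom.map_appLE _ _ _).trans (key _ _ (Δ.chartMap_chartι h))
  exact congrArg (fun f => f.hom (Δ.chartSection σ a)) h4

open Classical in
/-- The rays `ρ` with `z ∈ V(ρ)`. -/
noncomputable def raysThrough (z : Δ.toricVariety) : Finset Δ.Ray :=
  Finset.univ.filter fun ρ => z ∈ Δ.rayDivisor ρ

variable {Δ} in
theorem mem_raysThrough {z : Δ.toricVariety} {ρ : Δ.Ray} :
    ρ ∈ Δ.raysThrough z ↔ z ∈ Δ.rayDivisor ρ := by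
  simp [raysThrough]

end Charts

section Divisors

variable {N : Type} [AddCommGroup N] [Module.Free ℤ N] [Module.Finite ℤ N] (Δ : SmoothFan N)

/-- On `U_ρ` every monomial outside `ρ^⊥` is a multiple of the local equation of `V(ρ)`. -/
theorem mem_orbit_iff {ρ : Δ.Ray} (w : chart ρ.1.1) :
    Δ.chartι ρ.1 w ∈ Δ.orbit ρ.1 ↔
      Δ.rayEquation (le_refl ρ.1) ∈ (show PrimeSpectrum (ChartRing ρ.1.1) from w).asIdeal := by
  constructor
  · rintro ⟨w', hw', h⟩
    rw [← Δ.chartι_injective ρ.1 h]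
    refine hw' _ ⟨_, Δ.primitiveGenerator_mem ρ, ?_⟩
    rw [realPairing_tmul, Δ.dualVector_self le_rfl]
    simp
  · intro h
    refine ⟨w, fun m ⟨v, hv, hne⟩ => ?_, rfl⟩
    have hm : m.1 (Δ.primitiveGenerator ρ) ≠ 0 := by
      intro h0
      rw [ray_eq_hull] at hv
      obtain ⟨a, rfl⟩ := Submodule.mem_span_singleton.1 hv
      apply hne
      change realPairing m.1 ((a : ℝ) • ((1 : ℝ) ⊗ₜ[ℤ] Δ.primitiveGenerator ρ)) = 0
      rw [map_smul, realPairing_tmul, h0]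
      simp
    exact (Ideal.span_singleton_le_iff_mem _).2 h
      ((Δ.monomial_mem_span_rayEquation le_rfl m).2 hm)

/-- The dual vectors of `ρ` in `σ` and in `ρ` both take the value `1` on `n(ρ)`, so their monomials
differ by a unit on `U_ρ`. -/
theorem chartRingMap_rayEquation_mem {ρ : Δ.Ray} {σ : Δ.Cone} (h : ρ.1 ≤ σ)
    (w : chart ρ.1.1) :
    chartRingMap (σ := σ.1) (τ := ρ.1.1) h (Δ.rayEquation h) ∈
        (show PrimeSpectrum (ChartRing ρ.1.1) from w).asIdeal ↔
      Δ.rayEquation (le_refl ρ.1) ∈ (show PrimeSpectrum (ChartRing ρ.1.1) from w).asIdeal := by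
  have h1 : ∀ m : dualMonoid ρ.1.1, m.1 (Δ.primitiveGenerator ρ) = 1 →
      Ideal.span {monomial ρ.1.1 m} = Ideal.span {Δ.rayEquation (le_refl ρ.1)} := by
    intro m hm
    apply le_antisymm
    · rw [Ideal.span_singleton_le_iff_mem, monomial_mem_span_rayEquation, hm]
      exact one_ne_zero
    · rw [Ideal.span_singleton_le_iff_mem, rayEquation]
      refine single_mem_span_monomial (m := m) (m' := ⟨_, Δ.dualVector_mem le_rfl⟩) ?_ 1
      rw [mem_dualMonoid_iff]
      intro ρ' hρ'
      obtain rfl : ρ' = ρ := by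
        by_contra hne
        have h3 := Δ.le_zeroCone_of_le_ray hρ' fun h4 => hne (Subtype.ext (le_antisymm hρ' h4))
        exact Δ.ray_not_le_zeroCone ρ' h3.le
      rw [LinearMap.sub_apply, hm, Δ.dualVector_self le_rfl, sub_self]
  have h2 := h1 ⟨Δ.dualVector σ ρ, dualMonoid_anti h (Δ.dualVector_mem h)⟩ (Δ.dualVector_self h)
  rw [rayEquation, chartRingMap_monomial, ← Ideal.span_singleton_le_iff_mem, h2,
    Ideal.span_singleton_le_iff_mem]

/-- A chart that meets the orbit of `ρ` belongs to a cone containing `ρ`: otherwise the point of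
intersection lies in the torus, where no monomial vanishes. -/
theorem orbit_inter_chart {ρ : Δ.Ray} {σ : Δ.Cone} {x : chart σ.1}
    (hx : Δ.chartι σ x ∈ Δ.orbit ρ.1) : ∃ h : ρ.1 ≤ σ,
      Δ.rayEquation h ∈ (show PrimeSpectrum (ChartRing σ.1) from x).asIdeal := by
  obtain ⟨w, -, hwx⟩ := id hx
  rw [← hwx, mem_orbit_iff] at hx
  by_cases h : ρ.1 ≤ σ
  · refine ⟨h, ?_⟩
    rw [← Δ.chartRingMap_rayEquation_mem h] at hx
    rw [← Δ.chartι_chartMap_apply h] at hwx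
    rw [← Δ.chartι_injective σ hwx]
    exact hx
  · exfalso
    obtain ⟨τ, l, l', y, hy⟩ := Δ.exists_le_of_chartι_eq hwx
    have hτ := Δ.le_zeroCone_of_le_ray l fun h' => h (h'.trans l')
    -- On the torus chart every monomial is a unit.
    have hneg : -Δ.dualVector ρ.1 ρ ∈ dualMonoid τ.1 := fun v hv => by
      rw [hτ] at hv
      rw [(Submodule.mem_bot _).1 hv, map_zero]
    have hmem : chartRingMap (σ := ρ.1.1) (τ := τ.1) l (Δ.rayEquation (le_refl ρ.1)) ∈
        (show PrimeSpectrum (ChartRing τ.1) from y).asIdeal := by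
      rw [← hy] at hx
      exact hx
    rw [rayEquation, chartRingMap_monomial] at hmem
    have h1 := Ideal.mul_mem_right (monomial τ.1 ⟨_, hneg⟩) _ hmem
    rw [← monomial_add] at h1
    have h2 : (⟨Δ.dualVector ρ.1 ρ, dualMonoid_anti l (Δ.dualVector_mem le_rfl)⟩ +
        ⟨_, hneg⟩ : dualMonoid τ.1) = 0 := by
      ext1
      simp
    rw [h2, monomial_zero] at h1
    exact (show PrimeSpectrum (ChartRing τ.1) from y).isPrime.ne_top
      ((Ideal.eq_top_iff_one _).2 h1)

/-- The generic point of the divisor `V(ρ)` in the chart `U_σ`. -/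
noncomputable def rayPoint {ρ : Δ.Ray} {σ : Δ.Cone} (h : ρ.1 ≤ σ) : chart σ.1 :=
  (⟨Ideal.span {Δ.rayEquation h}, Δ.rayEquation_isPrime h⟩ : PrimeSpectrum (ChartRing σ.1))

theorem rayPoint_mem_orbit {ρ : Δ.Ray} {σ : Δ.Cone} (h : ρ.1 ≤ σ) :
    Δ.chartι σ (Δ.rayPoint h) ∈ Δ.orbit ρ.1 := by
  classical
  have hA : {ρ} ⊆ Δ.raysOf σ := Finset.singleton_subset_iff.2 (mem_raysOf.2 h)
  have h1 := Δ.mem_range_chartMap_iSup hA (Δ.rayPoint h) fun ρ' h' hne => by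
    change Δ.rayEquation h' ∉ Ideal.span {Δ.rayEquation h}
    exact fun hm => (Δ.monomial_mem_span_rayEquation h _).1 hm
      (Δ.dualVector_of_ne h' h (by simpa using hne))
  obtain ⟨w, hw⟩ := Δ.mem_range_chartMap_of_eq h (by simp) h1
  rw [← hw, chartι_chartMap_apply, mem_orbit_iff, ← Δ.chartRingMap_rayEquation_mem h]
  change Δ.rayEquation h ∈
    (show PrimeSpectrum (ChartRing σ.1) from chartMap (σ := σ.1) (τ := ρ.1.1) h w).asIdeal
  rw [hw]
  exact Ideal.subset_span rfl

/-- On the chart `U_σ` the divisor `V(ρ)` is cut out by `e(m_ρ)` if `ρ` is a ray of `σ`, and is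
empty otherwise. -/
theorem chartι_mem_rayDivisor {ρ : Δ.Ray} {σ : Δ.Cone} (x : chart σ.1) :
    Δ.chartι σ x ∈ Δ.rayDivisor ρ ↔ ∃ h : ρ.1 ≤ σ,
      Δ.rayEquation h ∈ (show PrimeSpectrum (ChartRing σ.1) from x).asIdeal := by
  change Δ.chartι σ x ∈ closure (Δ.orbit ρ.1) ↔ _
  constructor
  · intro hx
    have h1 : x ∈ closure (Δ.chartι σ ⁻¹' Δ.orbit ρ.1) := by
      rw [← (Δ.chartι σ).isOpenEmbedding.isOpenMap.preimage_closure_eq_closure_preimage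
        (Δ.chartι σ).continuous]
      exact hx
    have hne : ρ.1 ≤ σ := by
      by_contra h
      have : Δ.chartι σ ⁻¹' Δ.orbit ρ.1 = ∅ := by
        ext y
        exact ⟨fun hy => h (Δ.orbit_inter_chart hy).1, fun hy => hy.elim⟩
      rw [this, closure_empty] at h1
      exact h1
    refine ⟨hne, ?_⟩
    have h2 : closure (Δ.chartι σ ⁻¹' Δ.orbit ρ.1) ⊆
        PrimeSpectrum.zeroLocus ({Δ.rayEquation hne} : Set (ChartRing σ.1)) := by
      refine closure_minimal ?_ (PrimeSpectrum.isClosed_zeroLocus _)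
      intro y hy
      obtain ⟨_, hy'⟩ := Δ.orbit_inter_chart hy
      exact Set.singleton_subset_iff.2 hy'
    exact Set.singleton_subset_iff.1 (h2 h1)
  · rintro ⟨h, hx⟩
    have hs : Δ.rayPoint h ⤳ x :=
      (PrimeSpectrum.le_iff_specializes _ _).1 ((Ideal.span_singleton_le_iff_mem _).2 hx)
    have hs' := hs.map (Δ.chartι σ).continuous
    exact hs'.mem_closed isClosed_closure (subset_closure (Δ.rayPoint_mem_orbit h))

theorem vanishingIdeal_rayDivisor {ρ : Δ.Ray} {σ : Δ.Cone} (h : ρ.1 ≤ σ) :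
    (Scheme.IdealSheafData.vanishingIdeal (Δ.rayDivisor ρ)).ideal
      ⟨Δ.chartOpen σ, Δ.isAffineOpen_chartOpen σ⟩ =
        Ideal.span {Δ.chartSection σ (Δ.rayEquation h)} := by
  apply le_antisymm
  · intro s hs
    obtain ⟨a, rfl⟩ := (Δ.chartSection_bijective σ).2 s
    rw [NormalVariety.mem_vanishingIdeal_iff] at hs
    have h1 := hs _ (Δ.chartι_mem σ (Δ.rayPoint h))
      ((Δ.chartι_mem_rayDivisor _).2 ⟨h, Ideal.subset_span rfl⟩)
    rw [chartι_mem_basicOpen, not_not] at h1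
    obtain ⟨c, rfl⟩ := Ideal.mem_span_singleton.1 h1
    rw [RingHom.map_mul]
    exact Ideal.mul_mem_right _ _ (Ideal.subset_span rfl)
  · rw [Ideal.span_singleton_le_iff_mem, NormalVariety.mem_vanishingIdeal_iff]
    intro z hz hzV
    obtain ⟨x, rfl⟩ := Δ.mem_chartOpen.1 hz
    rw [chartι_mem_basicOpen, not_not]
    exact ((Δ.chartι_mem_rayDivisor x).1 hzV).2

theorem raysThrough_subset {z : Δ.toricVariety} {σ : Δ.Cone} (hz : z ∈ Δ.chartOpen σ) :
    Δ.raysThrough z ⊆ Δ.raysOf σ := by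
  intro ρ hρ
  obtain ⟨x, rfl⟩ := Δ.mem_chartOpen.1 hz
  exact mem_raysOf.2 ((Δ.chartι_mem_rayDivisor x).1 (mem_raysThrough.1 hρ)).1

theorem iSup_raysThrough_mem (z : Δ.toricVariety) : (⨆ ρ ∈ Δ.raysThrough z, ρ.1.1) ∈ Δ.cones := by
  obtain ⟨σ, hz⟩ := Δ.exists_mem_chartOpen z
  exact Δ.iSup_rays_mem σ (Δ.raysThrough_subset hz)

/-- A point of the toric variety lies in the chart of the cone spanned by the rays `ρ` with
`z ∈ V(ρ)`. -/
theorem mem_chartOpen_of_eq_iSup {z : Δ.toricVariety} {τ : Δ.Cone}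
    (hτ : τ.1 = ⨆ ρ ∈ Δ.raysThrough z, ρ.1.1) : z ∈ Δ.chartOpen τ := by
  obtain ⟨σ, hz⟩ := Δ.exists_mem_chartOpen z
  have hsub := Δ.raysThrough_subset hz
  obtain ⟨x, rfl⟩ := Δ.mem_chartOpen.1 hz
  have h1 := Δ.mem_range_chartMap_iSup hsub x fun ρ h hρ hx =>
    hρ (mem_raysThrough.2 ((Δ.chartι_mem_rayDivisor x).2 ⟨h, hx⟩))
  have hle : τ ≤ σ := by
    change τ.1 ≤ σ.1
    rw [hτ]
    exact iSup₂_le fun ρ hρ => mem_raysOf.1 (hsub hρ)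
  exact Δ.chartι_mem_chartOpen hle (Δ.mem_range_chartMap_of_eq hle hτ.symm h1)

theorem mem_torus_iff {z : Δ.toricVariety} : z ∈ Δ.torus ↔ ∀ ρ, z ∉ Δ.rayDivisor ρ := by
  constructor
  · intro hz ρ hρ
    exact Δ.ray_not_le_zeroCone ρ
      (mem_raysOf.1 (Δ.raysThrough_subset (σ := Δ.zeroCone) hz (mem_raysThrough.2 hρ)))
  · intro h
    refine Δ.mem_chartOpen_of_eq_iSup (τ := Δ.zeroCone) ?_
    have : Δ.raysThrough z = ∅ := by
      ext ρ
      simp [mem_raysThrough, h ρ]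
    rw [this]
    simp [zeroCone]

end Divisors

end SmoothFan

end Toric

/-! ### Noetherian normal domains -/

/-- In a Noetherian normal domain, an associated prime `(b : c)` of a nonzero principal ideal has
height one. -/
theorem Ideal.height_eq_one_of_forall_mul_mem_span {R : Type*} [CommRing R] [IsDomain R]
    [IsNoetherianRing R] [IsIntegrallyClosed R] {b c : R} (hb : b ≠ 0) (P : Ideal R) [P.IsPrime]
    (hP : ∀ r, r ∈ P ↔ r * c ∈ Ideal.span {b}) : P.height = 1 := by
  have hbP : b ∈ P := (hP b).2 (Ideal.mul_mem_right _ _ (Ideal.mem_span_singleton_self b))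
  have hcb : c ∉ Ideal.span {b} := fun h =>
    (inferInstance : P.IsPrime).ne_top ((Ideal.eq_top_iff_one _).2 ((hP 1).2 (by rwa [one_mul])))
  -- Otherwise `c / b` would preserve `P` and hence be integral over `R`.
  obtain ⟨t, u, ht, htu, hu⟩ : ∃ t u, t ∈ P ∧ t * c = b * u ∧ u ∉ P := by
    by_contra! hcon
    let K := FractionRing R
    have hb' : algebraMap R K b ≠ 0 := IsFractionRing.to_map_eq_zero_iff.not.mpr hb
    let x : K := algebraMap R K c / algebraMap R K b
    have hx : IsIntegral R x := by
      refine isIntegral_of_smul_mem_submodule (Submodule.map (Algebra.linearMap R K) P) ?_ ?_ x ?_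
      · rw [Submodule.ne_bot_iff]
        exact ⟨_, ⟨b, hbP, rfl⟩, hb'⟩
      · exact Submodule.FG.map _ (IsNoetherian.noetherian P)
      · rintro _ ⟨t, ht, rfl⟩
        obtain ⟨u, hu⟩ := Ideal.mem_span_singleton.1 ((hP t).1 ht)
        refine ⟨u, hcon t u ht hu, ?_⟩
        rw [Algebra.linearMap_apply, Algebra.linearMap_apply, smul_eq_mul, div_mul_eq_mul_div,
          eq_div_iff hb', ← map_mul, ← map_mul, mul_comm c t, hu, mul_comm]
    obtain ⟨y, hy⟩ := IsIntegrallyClosed.algebraMap_eq_of_integral hx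
    refine hcb (Ideal.mem_span_singleton.2 ⟨y, IsFractionRing.injective R K ?_⟩)
    rw [map_mul, hy, mul_div_cancel₀ _ hb']
  have hmin : P ∈ (Ideal.span {t}).minimalPrimes := by
    refine ⟨⟨inferInstance, (Ideal.span_singleton_le_iff_mem _).2 ht⟩,
      fun Q ⟨hQ, htQ⟩ hQP s hs => ?_⟩
    obtain ⟨v, hv⟩ := Ideal.mem_span_singleton.1 ((hP s).1 hs)
    have h1 : u * s = v * t := by
      apply mul_left_cancel₀ hb
      calc b * (u * s) = (t * c) * s := by rw [htu]; ring
        _ = (s * c) * t := by ring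
        _ = b * (v * t) := by rw [hv]; ring
    have h2 : u * s ∈ Q := by
      rw [h1]
      exact Q.mul_mem_left _ (htQ (Ideal.mem_span_singleton_self t))
    exact (hQ.mem_or_mem h2).resolve_left fun h => hu (hQP h)
  have h1 := Ideal.height_le_one_of_isPrincipal_of_mem_minimalPrimes _ P hmin
  refine le_antisymm h1 (Order.one_le_iff_pos.2 (pos_iff_ne_zero.2 fun h => ?_))
  rw [Ideal.height_eq_zero_iff_eq_bot] at h
  rw [h] at hbP
  exact hb hbP

/-- A Noetherian normal domain is the intersection of its localizations at the primes of height
one. -/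
theorem IsIntegrallyClosed.mem_range_algebraMap_of_height_one {R : Type*} [CommRing R] [IsDomain R]
    [IsNoetherianRing R] [IsIntegrallyClosed R] {K : Type*} [Field K] [Algebra R K]
    [IsFractionRing R K] (g : K)
    (h : ∀ (P : Ideal R) [P.IsPrime], P.height = 1 →
      ∃ a s : R, s ∉ P ∧ g * algebraMap R K s = algebraMap R K a) :
    g ∈ Set.range (algebraMap R K) := by
  obtain ⟨a, b, hb, rfl⟩ := IsFractionRing.div_surjective (A := R) g
  have hb0 : b ≠ 0 := nonZeroDivisors.ne_zero hb
  have hb' : algebraMap R K b ≠ 0 := IsFractionRing.to_map_eq_zero_iff.not.mpr hb0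
  by_cases hab : a ∈ Ideal.span {b}
  · obtain ⟨c, rfl⟩ := Ideal.mem_span_singleton.1 hab
    exact ⟨c, by rw [map_mul, mul_div_cancel_left₀ _ hb']⟩
  exfalso
  obtain ⟨P, hP, hle⟩ := exists_le_isAssociatedPrime_of_isNoetherianRing R
    (Ideal.Quotient.mk (Ideal.span {b}) a) (by rwa [Ne, Ideal.Quotient.eq_zero_iff_mem])
  obtain ⟨hPp, x, hx⟩ := isAssociatedPrime_iff.1 hP
  obtain ⟨c, rfl⟩ := Ideal.Quotient.mk_surjective x
  have hmem : ∀ c r : R, r ∈ (⊥ : Submodule R (R ⧸ Ideal.span {b})).colon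
      {Ideal.Quotient.mk (Ideal.span {b}) c} ↔ r * c ∈ Ideal.span {b} := fun c r => by
    rw [Submodule.mem_colon_singleton, Submodule.mem_bot, ← Ideal.Quotient.eq_zero_iff_mem]
    rfl
  have hone := Ideal.height_eq_one_of_forall_mul_mem_span hb0 P fun r => by rw [hx, hmem]
  obtain ⟨a', s, hs, hsa⟩ := h P hone
  refine hs (hle ((hmem a s).2 (Ideal.mem_span_singleton.2 ⟨a', ?_⟩)))
  apply IsFractionRing.injective R K
  rw [div_mul_eq_mul_div, div_eq_iff hb', ← map_mul, ← map_mul] at hsa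
  rw [mul_comm s a, hsa, mul_comm]

namespace Toric

namespace NormalVariety

variable (Y : NormalVariety)

/-! ### Regular functions and prime divisors on a normal variety -/

/-- The stalk at the point of an affine open subset given by a prime ideal is the localization. -/
theorem exists_stalk_isLocalization {U : Y.carrier.Opens} (hU : IsAffineOpen U)
    (p : PrimeSpectrum Γ(Y.carrier, U)) :
    ∃ hp : hU.fromSpec p ∈ U,
      letI := (Y.carrier.presheaf.germ U (hU.fromSpec p) hp).hom.toAlgebra
      IsLocalization.AtPrime (Y.carrier.presheaf.stalk (hU.fromSpec p)) p.asIdeal := by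
  have hp : hU.fromSpec p ∈ U := by
    rw [← SetLike.mem_coe, ← hU.range_fromSpec]
    exact ⟨p, rfl⟩
  exact ⟨hp, hU.isLocalization_stalk' p hp⟩

theorem coheight_fromSpec {U : Y.carrier.Opens} (hU : IsAffineOpen U)
    (p : Spec Γ(Y.carrier, U)) : Order.coheight (hU.fromSpec p) = p.asIdeal.height :=
  (coheight_eq_of_isOpenImmersion (x := p) hU.fromSpec).trans (idealHeight_eq_coheight _ p).symm

theorem fromSpec_mem_basicOpen {U : Y.carrier.Opens} (hU : IsAffineOpen U)
    (p : PrimeSpectrum Γ(Y.carrier, U)) (s : Γ(Y.carrier, U)) :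
    hU.fromSpec p ∈ Y.carrier.basicOpen s ↔ s ∉ p.asIdeal :=
  SetLike.ext_iff.1 (hU.fromSpec_preimage_basicOpen s) p

theorem isIntegrallyClosed_section {U : Y.carrier.Opens} [Nonempty U] (hU : IsAffineOpen U) :
    IsIntegrallyClosed Γ(Y.carrier, U) := by
  refine IsIntegrallyClosed.of_localization_maximal fun p _ _ => ?_
  obtain ⟨hp, hloc⟩ := Y.exists_stalk_isLocalization hU ⟨p, inferInstance⟩
  let := (Y.carrier.presheaf.germ U (hU.fromSpec ⟨p, inferInstance⟩) hp).hom.toAlgebra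
  exact IsIntegrallyClosed.of_equiv
    (IsLocalization.algEquiv p.primeCompl
      (Y.carrier.presheaf.stalk (hU.fromSpec ⟨p, inferInstance⟩))
      (Localization.AtPrime p)).toRingEquiv

/-- A rational function on a normal variety that is regular at all prime divisors meeting an
affine open subset `U` is regular on `U`. -/
theorem mem_range_germToFunctionField {U : Y.carrier.Opens} [Nonempty U] (hU : IsAffineOpen U)
    (g : Y.carrier.functionField)
    (h : ∀ P : Y.PrimeDivisor, P.1 ∈ U →
      g ∈ Set.range (algebraMap (Y.carrier.presheaf.stalk P.1) Y.carrier.functionField)) :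
    g ∈ Set.range (Y.carrier.germToFunctionField U) := by
  have := Y.isIntegrallyClosed_section hU
  have := functionField_isFractionRing_of_isAffineOpen Y.carrier U hU
  have : IsNoetherianRing Γ(Y.carrier, U) :=
    IsLocallyNoetherian.component_noetherian ⟨U, hU⟩
  refine IsIntegrallyClosed.mem_range_algebraMap_of_height_one (R := Γ(Y.carrier, U)) g ?_
  intro p hp hone
  let p' : PrimeSpectrum Γ(Y.carrier, U) := ⟨p, hp⟩
  obtain ⟨hpU, hloc⟩ := Y.exists_stalk_isLocalization hU p'
  obtain ⟨t, rfl⟩ := h ⟨hU.fromSpec p', (Y.coheight_fromSpec hU p').trans hone⟩ hpU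
  let := (Y.carrier.presheaf.germ U (hU.fromSpec p') hpU).hom.toAlgebra
  obtain ⟨⟨a, s⟩, has⟩ := IsLocalization.surj p.primeCompl t
  refine ⟨a, s, s.2, ?_⟩
  have h1 : ∀ r : Γ(Y.carrier, U), algebraMap Γ(Y.carrier, U) Y.carrier.functionField r =
      algebraMap (Y.carrier.presheaf.stalk (hU.fromSpec p')) Y.carrier.functionField
        (Y.carrier.presheaf.germ U (hU.fromSpec p') hpU r) := fun r =>
    (Scheme.algebraMap_germ_eq_germToFunctionField Y.carrier hpU r).symm
  rw [h1, h1, ← map_mul]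
  exact congrArg _ has

/-- Every zero of a nonzero regular function lies on a prime divisor along which the function
vanishes. -/
theorem exists_primeDivisor_of_notMem_basicOpen {U : Y.carrier.Opens} (hU : IsAffineOpen U)
    {u : Γ(Y.carrier, U)} (hu : u ≠ 0) {y : Y.carrier} (hy : y ∈ U)
    (hyu : y ∉ Y.carrier.basicOpen u) :
    ∃ P : Y.PrimeDivisor, P.1 ⤳ y ∧ P.1 ∈ U ∧ P.1 ∉ Y.carrier.basicOpen u := by
  have : Nonempty U := ⟨⟨y, hy⟩⟩
  have : IsNoetherianRing Γ(Y.carrier, U) :=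
    IsLocallyNoetherian.component_noetherian ⟨U, hU⟩
  rw [← SetLike.mem_coe, ← hU.range_fromSpec] at hy
  obtain ⟨q, rfl⟩ := hy
  have huq := not_not.1 ((Y.fromSpec_mem_basicOpen hU q u).not.1 hyu)
  have := q.2
  obtain ⟨p, hp, hpq⟩ := Ideal.exists_minimalPrimes_le (J := q.asIdeal)
    ((Ideal.span_singleton_le_iff_mem _).2 huq)
  have hup : u ∈ p := hp.1.2 (Ideal.mem_span_singleton_self u)
  have hpp : p.IsPrime := hp.1.1
  have h1 := Ideal.height_le_one_of_isPrincipal_of_mem_minimalPrimes _ p hp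
  have h2 : p.height = 1 := by
    refine le_antisymm h1 (Order.one_le_iff_pos.2 (pos_iff_ne_zero.2 fun h => ?_))
    rw [Ideal.height_eq_zero_iff_eq_bot] at h
    rw [h] at hup
    exact hu hup
  let p' : PrimeSpectrum Γ(Y.carrier, U) := ⟨p, hpp⟩
  refine ⟨⟨hU.fromSpec p', (Y.coheight_fromSpec hU p').trans h2⟩, ?_,
    (Y.exists_stalk_isLocalization hU p').1, ?_⟩
  · have h3 : p' ⤳ q := (PrimeSpectrum.le_iff_specializes _ _).1 hpq
    exact Specializes.map h3 hU.fromSpec.continuous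
  · rw [fromSpec_mem_basicOpen, not_not]
    exact hup

instance : IsNoetherian Y.carrier where
  isCompact_univ := (QuasiCompact.compactSpace_of_compactSpace Y.toSpecℂ).isCompact_univ

/-- A proper closed subset of a variety contains only finitely many prime divisors. -/
theorem finite_primeDivisor_of_isClosed {Z : Set Y.carrier} (hZ : IsClosed Z)
    (hgen : genericPoint Y.carrier ∉ Z) : {P : Y.PrimeDivisor | P.1 ∈ Z}.Finite := by
  obtain ⟨S, hS, hcl, hirr, rfl⟩ := NoetherianSpace.exists_finite_set_isClosed_irreducible hZ
  -- A prime divisor in the union is the generic point of one of the components.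
  have key : ∀ P : Y.PrimeDivisor, P.1 ∈ ⋃₀ S → closure {P.1} ∈ S := by
    intro P hP
    obtain ⟨T, hT, hPT⟩ := hP
    obtain ⟨Q, hQ⟩ := QuasiSober.sober (hirr T hT) (hcl T hT)
    have hQP : Q ⤳ P.1 := hQ.specializes hPT
    have hQ' : Q ≠ genericPoint Y.carrier := by
      rintro rfl
      exact hgen ⟨T, hT, hQ.mem⟩
    have hle : P.1 ≤ Q := Scheme.le_iff_specializes.2 hQP
    have : P.1 = Q := by
      by_contra hne
      have h1 : P.1 < Q := lt_of_le_not_ge hle fun h =>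
        hne ((Scheme.le_iff_specializes.1 h).antisymm hQP).eq
      have h2 : Q < genericPoint Y.carrier :=
        lt_of_le_not_ge (Scheme.le_iff_specializes.2 (genericPoint_specializes Q)) fun h =>
          hQ' ((Scheme.le_iff_specializes.1 h).antisymm (genericPoint_specializes Q)).eq
      have h3 := Order.coheight_add_one_le h1
      have h4 := Order.coheight_add_one_le h2
      rw [P.2] at h3
      have h5 : (1 : ℕ∞) + 1 ≤ 1 :=
        (add_le_add_left ((le_add_self).trans h4) 1).trans h3
      exact absurd h5 (by decide)
    rw [this, hQ.def]
    exact hT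
  refine Set.Finite.of_finite_image (f := fun P : Y.PrimeDivisor => closure {P.1})
    (hS.subset ?_) ?_
  · rintro _ ⟨P, hP, rfl⟩
    exact key P hP
  · intro P _ P' _ h
    exact Subtype.ext (by
      have h1 : IsGenericPoint P.1 (closure {P.1}) := rfl
      have h2 : IsGenericPoint P'.1 (closure {P.1}) := h.symm
      exact h1.eq h2)

instance (P : Y.PrimeDivisor) : Ring.KrullDimLE 1 (Y.carrier.presheaf.stalk P.1) :=
  krullDimLE_of_coheight_le P.2.le

instance (P : Y.PrimeDivisor) : IsDiscreteValuationRing (Y.carrier.presheaf.stalk P.1) := by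
  have hdim := ringKrullDim_stalk_eq_coheight P.1
  rw [P.2] at hdim
  have hfield : ¬ IsField (Y.carrier.presheaf.stalk P.1) := fun h => by
    rw [ringKrullDim_eq_zero_of_isField h] at hdim
    exact absurd hdim (by decide)
  refine ((IsDiscreteValuationRing.TFAE _ hfield).out 0 2).2 ?_
  have h1 : Ring.DimensionLEOne (Y.carrier.presheaf.stalk P.1) :=
    ⟨fun {p} hp hp' => Ring.krullDimLE_one_iff_of_isPrime_bot.1 inferInstance p hp hp'⟩
  exact { }

/-- The order along a prime divisor of a function that is regular there is the length of the local
ring modulo the function. -/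
theorem ord_algebraMap (P : Y.PrimeDivisor) {a : Y.carrier.presheaf.stalk P.1} (ha : a ≠ 0) :
    Scheme.ord (algebraMap _ Y.carrier.functionField a) P.1 =
      (Ring.ord (Y.carrier.presheaf.stalk P.1) a).toNat := by
  have hne : Ring.ord (Y.carrier.presheaf.stalk P.1) a ≠ ⊤ :=
    Ring.ord_ne_top (mem_nonZeroDivisors_of_ne_zero ha)
  rw [Scheme.ord_eq_iff P.2 (IsFractionRing.to_map_eq_zero_iff.not.mpr ha)]
  change Ring.ordFrac (Y.carrier.presheaf.stalk P.1) _ = _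
  rw [Ring.ordFrac_eq_ord _ ha]
  exact Ring.ordMonoidWithZeroHom_eq_coe _ (mem_nonZeroDivisors_of_ne_zero ha)
    (ENat.natCast_toNat hne).symm

/-- A rational function of nonnegative order along `P` lies in the discrete valuation ring at `P`. -/
theorem mem_range_of_ord_nonneg (P : Y.PrimeDivisor) {g : Y.carrier.functionField} (hg : g ≠ 0)
    (h : 0 ≤ Scheme.ord g P.1) :
    g ∈ Set.range (algebraMap (Y.carrier.presheaf.stalk P.1) Y.carrier.functionField) := by
  obtain ⟨a, b, hb, rfl⟩ := IsFractionRing.div_surjective (A := Y.carrier.presheaf.stalk P.1) g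
  have hb0 : b ≠ 0 := nonZeroDivisors.ne_zero hb
  have hb' : algebraMap _ Y.carrier.functionField b ≠ 0 :=
    IsFractionRing.to_map_eq_zero_iff.not.mpr hb0
  have ha' : algebraMap _ Y.carrier.functionField a ≠ 0 := fun h => hg (by rw [h, zero_div])
  have ha0 : a ≠ 0 := fun h => ha' (by rw [h, map_zero])
  have h1 := Scheme.ord_mul (x := P.1) hg hb'
  rw [div_mul_cancel₀ _ hb', ord_algebraMap Y P ha0, ord_algebraMap Y P hb0] at h1
  have h2 : (Ring.ord _ b).toNat ≤ (Ring.ord _ a).toNat := by omega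
  have h3 : Ring.ord _ b ≤ Ring.ord _ a := by
    rw [← ENat.natCast_toNat (Ring.ord_ne_top (mem_nonZeroDivisors_of_ne_zero ha0)),
      ← ENat.natCast_toNat (Ring.ord_ne_top hb)]
    exact_mod_cast h2
  rw [Ring.ord_eq_addVal, Ring.ord_eq_addVal, IsDiscreteValuationRing.addVal_le_iff_dvd] at h3
  obtain ⟨c, rfl⟩ := h3
  exact ⟨c, by rw [map_mul, mul_div_cancel_left₀ _ hb']⟩

end NormalVariety

/-! ### Morphisms to a toric variety -/

theorem le_preimage_top {S S' : Scheme.{0}} (s : S ⟶ S') (W : S.Opens) : W ≤ s ⁻¹ᵁ ⊤ :=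
  fun _ _ => trivial

/-- The structure morphism to `Spec ℂ` as the inclusion of the constants into the ring of sections
over an open subset. -/
noncomputable def constants {S : Scheme.{0}} (s : S ⟶ Spec (CommRingCat.of ℂ)) (W : S.Opens) :
    ℂ →+* Γ(S, W) :=
  ((Scheme.ΓSpecIso (CommRingCat.of ℂ)).inv ≫ s.appLE ⊤ W (le_preimage_top s W)).hom

theorem toSpecΓ_constants {S : Scheme.{0}} (s : S ⟶ Spec (CommRingCat.of ℂ)) (W : S.Opens) :
    W.toSpecΓ ≫ Spec.map (CommRingCat.ofHom (constants s W)) = W.ι ≫ s := by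
  have h1 : Spec.map (CommRingCat.ofHom (constants s W)) =
      Spec.map (s.appLE ⊤ W (le_preimage_top s W)) ≫
        Spec.map (Scheme.ΓSpecIso (CommRingCat.of ℂ)).inv :=
    Spec.map_comp _ _
  rw [h1, Scheme.Opens.toSpecΓ_SpecMap_appLE_assoc, Scheme.Opens.toSpecΓ_top, Category.assoc,
    toSpecΓ_SpecMap_ΓSpecIso_inv, Category.comp_id, Scheme.Hom.resLE_comp_ι]

theorem map_constants {S : Scheme.{0}} (s : S ⟶ Spec (CommRingCat.of ℂ)) {W W' : S.Opens}
    (h : W' ≤ W) (c : ℂ) :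
    S.presheaf.map (homOfLE h).op (constants s W c) = constants s W' c :=
  congrArg (fun k => k.hom ((Scheme.ΓSpecIso (CommRingCat.of ℂ)).inv c))
    (Scheme.Hom.appLE_map s (V := W) (V' := W') (le_preimage_top s W) (homOfLE h).op)

namespace SmoothFan

section

variable {N : Type} [AddCommGroup N] (Δ : SmoothFan N)

theorem SpecMap_chartSection_chartι (σ : Δ.Cone) :
    Spec.map (CommRingCat.ofHom (Δ.chartSection σ)) ≫ Δ.chartι σ =
      (Δ.isAffineOpen_chartOpen σ).fromSpec := by
  have h1 := IsAffineOpen.SpecMap_appLE_fromSpec (Δ.chartι σ) (Δ.isAffineOpen_chartOpen σ)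
    (isAffineOpen_top _) (Δ.le_preimage_chartOpen σ)
  rw [IsAffineOpen.fromSpec_top, Scheme.isoSpec_Spec_inv] at h1
  have h2 : CommRingCat.ofHom (Δ.chartSection σ) ≫
      (Δ.chartι σ).appLE (Δ.chartOpen σ) ⊤ (Δ.le_preimage_chartOpen σ) =
      (Scheme.ΓSpecIso (CommRingCat.of (ChartRing σ.1))).inv :=
    CommRingCat.hom_ext (RingHom.ext (Δ.chartSection_appLE σ))
  have : IsIso ((Δ.chartι σ).appLE (Δ.chartOpen σ) ⊤ (Δ.le_preimage_chartOpen σ)) := by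
    have : IsIso (CommRingCat.ofHom (Δ.chartSection σ)) :=
      (ConcreteCategory.isIso_iff_bijective _).2 (Δ.chartSection_bijective σ)
    exact IsIso.of_isIso_fac_left h2
  rw [← cancel_epi (Spec.map ((Δ.chartι σ).appLE (Δ.chartOpen σ) ⊤ (Δ.le_preimage_chartOpen σ))),
    h1, ← h2, Spec.map_comp, Category.assoc]

variable {S : Scheme.{0}}

/-- The morphism `W → U_σ ⊆ X` given by a homomorphism from the coordinate ring of the chart `U_σ`
to the ring of regular functions on `W`. -/
noncomputable def homOfRingHom (σ : Δ.Cone) {W : S.Opens} (φ : ChartRing σ.1 →+* Γ(S, W)) :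
    W.toScheme ⟶ Δ.toricVariety :=
  W.toSpecΓ ≫ Spec.map (CommRingCat.ofHom φ) ≫ Δ.chartι σ

theorem homOfRingHom_mem (σ : Δ.Cone) {W : S.Opens} (φ : ChartRing σ.1 →+* Γ(S, W))
    (w : W.toScheme) : Δ.homOfRingHom σ φ w ∈ Δ.chartOpen σ := by
  rw [homOfRingHom, Scheme.Hom.comp_apply, Scheme.Hom.comp_apply]
  exact Δ.chartι_mem σ _

theorem homOfRingHom_toSpecℂ (σ : Δ.Cone) {W : S.Opens} (φ : ChartRing σ.1 →+* Γ(S, W)) :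
    Δ.homOfRingHom σ φ ≫ Δ.toSpecℂ =
      W.toSpecΓ ≫ Spec.map (CommRingCat.ofHom (φ.comp (algebraMap ℂ (ChartRing σ.1)))) := by
  rw [homOfRingHom, Category.assoc, Category.assoc, chartι_toSpecℂ]
  exact congrArg (W.toSpecΓ ≫ ·) (Spec.map_comp (CommRingCat.ofHom (algebraMap ℂ (ChartRing σ.1)))
    (CommRingCat.ofHom φ)).symm

theorem homOfRingHom_injective (σ : Δ.Cone) {W : S.Opens} (hW : IsAffineOpen W) :
    Function.Injective (Δ.homOfRingHom σ (W := W)) := by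
  intro φ φ' h
  have : IsIso W.toSpecΓ := inferInstanceAs (IsIso hW.isoSpec.hom)
  simp only [homOfRingHom] at h
  rw [cancel_epi, cancel_mono] at h
  exact congrArg CommRingCat.Hom.hom (Spec.map_injective h)

/-- Enlarging the chart and shrinking the source. -/
theorem homOfLE_homOfRingHom {τ σ : Δ.Cone} (h : τ ≤ σ) {W W' : S.Opens} (i : W' ≤ W)
    (φ : ChartRing σ.1 →+* Γ(S, W)) (φ' : ChartRing τ.1 →+* Γ(S, W'))
    (hφ : ∀ a, S.presheaf.map (homOfLE i).op (φ a) =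
      φ' (chartRingMap (σ := σ.1) (τ := τ.1) h a)) :
    S.homOfLE i ≫ Δ.homOfRingHom σ φ = Δ.homOfRingHom τ φ' := by
  have h1 : CommRingCat.ofHom φ ≫ S.presheaf.map (homOfLE i).op =
      CommRingCat.ofHom (chartRingMap (σ := σ.1) (τ := τ.1) h) ≫ CommRingCat.ofHom φ' :=
    CommRingCat.hom_ext (RingHom.ext hφ)
  rw [homOfRingHom, homOfRingHom, ← Scheme.Opens.toSpecΓ_SpecMap_presheaf_map_assoc,
    ← Spec.map_comp_assoc, h1, Spec.map_comp_assoc, ← Δ.chartMap_chartι h]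
  rfl

variable {Δ}

/-- The pullback of functions on the chart `U_σ` along a morphism to the toric variety. -/
noncomputable def pullChart (f : S ⟶ Δ.toricVariety) (σ : Δ.Cone) {W : S.Opens}
    (h : W ≤ f ⁻¹ᵁ Δ.chartOpen σ) : ChartRing σ.1 →+* Γ(S, W) :=
  (f.appLE (Δ.chartOpen σ) W h).hom.comp (Δ.chartSection σ)

theorem ι_comp_eq_homOfRingHom (f : S ⟶ Δ.toricVariety) (σ : Δ.Cone) {W : S.Opens}
    (h : W ≤ f ⁻¹ᵁ Δ.chartOpen σ) : W.ι ≫ f = Δ.homOfRingHom σ (pullChart f σ h) := by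
  have h1 : Spec.map (CommRingCat.ofHom (pullChart f σ h)) =
      Spec.map (f.appLE (Δ.chartOpen σ) W h) ≫
        Spec.map (CommRingCat.ofHom (Δ.chartSection σ)) :=
    Spec.map_comp _ _
  rw [homOfRingHom, h1, Category.assoc, Δ.SpecMap_chartSection_chartι,
    Scheme.Opens.toSpecΓ_SpecMap_appLE_assoc, IsAffineOpen.toSpecΓ_fromSpec,
    Scheme.Hom.resLE_comp_ι]

theorem map_pullChart (f : S ⟶ Δ.toricVariety) (σ : Δ.Cone) {W W' : S.Opens}
    (h : W ≤ f ⁻¹ᵁ Δ.chartOpen σ) (i : W' ≤ W) (a : ChartRing σ.1) :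
    S.presheaf.map (homOfLE i).op (pullChart f σ h a) = pullChart f σ (i.trans h) a :=
  congrArg (fun k => k.hom (Δ.chartSection σ a)) (Scheme.Hom.appLE_map f h (homOfLE i).op)

theorem pullChart_chartRingMap (f : S ⟶ Δ.toricVariety) {τ σ : Δ.Cone} (hle : τ ≤ σ)
    {W : S.Opens} (h : W ≤ f ⁻¹ᵁ Δ.chartOpen τ) (h' : W ≤ f ⁻¹ᵁ Δ.chartOpen σ)
    (a : ChartRing σ.1) :
    pullChart f τ h (chartRingMap (σ := σ.1) (τ := τ.1) hle a) = pullChart f σ h' a := by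
  have h1 := Δ.map_chartSection hle a
  refine (congrArg (f.appLE (Δ.chartOpen τ) W h) h1).symm.trans ?_
  exact congrArg (fun k => k.hom (Δ.chartSection σ a))
    (Scheme.Hom.map_appLE f h (homOfLE (Δ.chartOpen_mono hle)).op)

theorem pullChart_algebraMap {f : S ⟶ Δ.toricVariety} {s : S ⟶ Spec (CommRingCat.of ℂ)}
    (hf : f ≫ Δ.toSpecℂ = s) (σ : Δ.Cone) {W : S.Opens} (hW : IsAffineOpen W)
    (h : W ≤ f ⁻¹ᵁ Δ.chartOpen σ) (c : ℂ) :
    pullChart f σ h (algebraMap ℂ (ChartRing σ.1) c) = constants s W c := by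
  have h1 := Δ.homOfRingHom_toSpecℂ σ (pullChart f σ h)
  rw [← ι_comp_eq_homOfRingHom, Category.assoc, hf, ← toSpecΓ_constants] at h1
  have : IsIso W.toSpecΓ := inferInstanceAs (IsIso hW.isoSpec.hom)
  rw [cancel_epi] at h1
  exact congrArg (fun k => k.hom c) (Spec.map_injective h1).symm

theorem mem_basicOpen_pullChart (f : S ⟶ Δ.toricVariety) (σ : Δ.Cone) {W : S.Opens}
    (h : W ≤ f ⁻¹ᵁ Δ.chartOpen σ) {y : S} (hy : y ∈ W) (a : ChartRing σ.1) :
    y ∈ S.basicOpen (pullChart f σ h a) ↔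
      f y ∈ Δ.toricVariety.basicOpen (Δ.chartSection σ a) := by
  have h1 : S.basicOpen (pullChart f σ h a) =
      W ⊓ f ⁻¹ᵁ (Δ.toricVariety.basicOpen (Δ.chartSection σ a)) :=
    Scheme.basicOpen_appLE f W (Δ.chartOpen σ) h (Δ.chartSection σ a)
  rw [h1]
  exact ⟨fun h => h.2, fun h => ⟨hy, h⟩⟩

end

section

variable {N : Type} [AddCommGroup N] [Module.Free ℤ N] [Module.Finite ℤ N] {Δ : SmoothFan N}
  {S : Scheme.{0}}

/-- The preimage of `V(ρ)` in the preimage of a chart `U_σ` with `ρ ≤ σ` is the zero set of the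
pullback of the equation of `V(ρ)`. -/
theorem mem_rayDivisor_iff_notMem_basicOpen (f : S ⟶ Δ.toricVariety) {σ : Δ.Cone} {ρ : Δ.Ray}
    (hρ : ρ.1 ≤ σ) {W : S.Opens} (h : W ≤ f ⁻¹ᵁ Δ.chartOpen σ) {y : S} (hy : y ∈ W) :
    f y ∈ Δ.rayDivisor ρ ↔ y ∉ S.basicOpen (pullChart f σ h (Δ.rayEquation hρ)) := by
  rw [mem_basicOpen_pullChart f σ h hy]
  obtain ⟨x, hx⟩ := Δ.mem_chartOpen.1 (h hy)
  rw [← hx, chartι_mem_rayDivisor, chartι_mem_basicOpen, not_not]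
  exact ⟨fun h => h.2, fun h => ⟨hρ, h⟩⟩

end

end SmoothFan

/-! ### The monomials as rational functions -/

section

variable {N : Type} [AddCommGroup N]

theorem mem_dualMonoid_bot (m : DualLattice N) :
    m ∈ dualMonoid (⊥ : PointedCone ℝ (RealSpace N)) := fun v hv => by
  rw [(Submodule.mem_bot _).1 hv, map_zero]

/-- The character `e(m)` as an element of the coordinate ring of the torus. -/
noncomputable def torusMonomial (m : DualLattice N) :
    ChartRing (⊥ : PointedCone ℝ (RealSpace N)) :=
  monomial ⊥ ⟨m, mem_dualMonoid_bot m⟩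

theorem torusMonomial_add (m m' : DualLattice N) :
    torusMonomial (m + m') = torusMonomial m * torusMonomial m' :=
  monomial_add ⟨m, mem_dualMonoid_bot m⟩ ⟨m', mem_dualMonoid_bot m'⟩

theorem torusMonomial_zero : torusMonomial (0 : DualLattice N) = 1 := rfl

/-- The characters as a homomorphism from `M` to the coordinate ring of the torus. -/
noncomputable def torusMonomialHom :
    Multiplicative (DualLattice N) →* ChartRing (⊥ : PointedCone ℝ (RealSpace N)) where
  toFun m := torusMonomial m.toAdd
  map_one' := torusMonomial_zero
  map_mul' m m' := torusMonomial_add m.toAdd m'.toAdd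

theorem map_torusMonomial_ne_zero {K : Type*} [Field K]
    (θ : ChartRing (⊥ : PointedCone ℝ (RealSpace N)) →+* K) (m : DualLattice N) :
    θ (torusMonomial m) ≠ 0 := by
  intro h
  have h1 : θ (torusMonomial (m + -m)) = 0 := by
    rw [torusMonomial_add, RingHom.map_mul, h, zero_mul]
  rw [add_neg_cancel, torusMonomial_zero, RingHom.map_one] at h1
  exact one_ne_zero h1

end

namespace NormalVariety

variable {N : Type} [AddCommGroup N] (Y : NormalVariety)

/-- The order along a prime divisor of the rational functions defined by the characters. -/
noncomputable def characterOrd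
    (θ : ChartRing (⊥ : PointedCone ℝ (RealSpace N)) →+* Y.carrier.functionField)
    (P : Y.PrimeDivisor) : DualLattice N →+ ℤ :=
  AddMonoidHom.mk' (fun m => Scheme.ord (θ (torusMonomial m)) P.1) fun m m' => by
    rw [torusMonomial_add, RingHom.map_mul, Scheme.ord_mul (map_torusMonomial_ne_zero θ m)
      (map_torusMonomial_ne_zero θ m')]

theorem ord_germ_nonneg (P : Y.PrimeDivisor) {W : Y.carrier.Opens} [Nonempty W] (hP : P.1 ∈ W)
    (g : Γ(Y.carrier, W)) : 0 ≤ Scheme.ord (Y.carrier.germToFunctionField W g) P.1 := by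
  rw [← Scheme.algebraMap_germ_eq_germToFunctionField Y.carrier hP]
  by_cases h : Y.carrier.presheaf.germ W P.1 hP g = 0
  · rw [h, map_zero, Scheme.ord_zero]
    exact le_rfl
  · rw [ord_algebraMap Y P h]
    exact Int.natCast_nonneg _

theorem genericPoint_mem {W : Y.carrier.Opens} {y : Y.carrier} (hy : y ∈ W) :
    genericPoint Y.carrier ∈ W :=
  (genericPoint_specializes y).mem_open W.isOpen hy

theorem germToFunctionField_map {W W' : Y.carrier.Opens} [Nonempty W] [Nonempty W'] (i : W' ≤ W)
    (s : Γ(Y.carrier, W)) :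
    Y.carrier.germToFunctionField W' (Y.carrier.presheaf.map (homOfLE i).op s) =
      Y.carrier.germToFunctionField W s :=
  TopCat.Presheaf.germ_res_apply Y.carrier.presheaf _ _ _ _

/-- The inclusion of the constants into the function field. -/
noncomputable def rationalConstants : ℂ →+* Y.carrier.functionField :=
  (Y.carrier.presheaf.germ ⊤ (genericPoint Y.carrier) trivial).hom.comp (constants Y.toSpecℂ ⊤)

theorem germToFunctionField_constants (W : Y.carrier.Opens) [Nonempty W] (c : ℂ) :
    Y.carrier.germToFunctionField W (constants Y.toSpecℂ W c) = Y.rationalConstants c := by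
  rw [← map_constants Y.toSpecℂ (le_top : W ≤ ⊤)]
  exact TopCat.Presheaf.germ_res_apply Y.carrier.presheaf _ _ _ _

end NormalVariety

namespace SmoothFan

section

variable {N : Type} [AddCommGroup N] [Module.Free ℤ N] [Module.Finite ℤ N] (Δ : SmoothFan N)

/-- A homomorphism `M → ℤ` that is nonnegative on `M ∩ σ^∨` is a combination of the primitive
generators of the rays of `σ`. -/
theorem addMonoidHom_eq_sum (σ : Δ.Cone) (l : DualLattice N →+ ℤ)
    (hl : ∀ m ∈ dualMonoid σ.1, 0 ≤ l m) (m : DualLattice N) :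
    l m = ∑ ρ ∈ Δ.raysOf σ, m (Δ.primitiveGenerator ρ) * l (Δ.dualVector σ ρ) := by
  classical
  set m₀ := m - ∑ ρ ∈ Δ.raysOf σ, m (Δ.primitiveGenerator ρ) • Δ.dualVector σ ρ with hm₀
  have h0 : ∀ ρ, ρ.1 ≤ σ → m₀ (Δ.primitiveGenerator ρ) = 0 := by
    intro ρ hρ
    rw [hm₀, LinearMap.sub_apply, LinearMap.sum_apply, Finset.sum_eq_single ρ]
    · simp [Δ.dualVector_self hρ]
    · intro ρ' hρ' hne
      simp [Δ.dualVector_of_ne (mem_raysOf.1 hρ') hρ hne]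
    · exact fun h => (h (mem_raysOf.2 hρ)).elim
  have h1 : 0 ≤ l m₀ := hl _ ((Δ.mem_dualMonoid_iff σ _).2 fun ρ hρ => (h0 ρ hρ).ge)
  have h2 : 0 ≤ l (-m₀) := hl _ ((Δ.mem_dualMonoid_iff σ _).2 fun ρ hρ => by
    rw [LinearMap.neg_apply, h0 ρ hρ, neg_zero])
  rw [map_neg] at h2
  have h3 : l m₀ = 0 := by omega
  have h4 : m = m₀ + ∑ ρ ∈ Δ.raysOf σ, m (Δ.primitiveGenerator ρ) • Δ.dualVector σ ρ := by
    rw [hm₀, sub_add_cancel]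
  conv_lhs => rw [h4]
  rw [map_add, h3, zero_add, map_sum]
  exact Finset.sum_congr rfl fun ρ _ => by rw [map_zsmul, smul_eq_mul]

end

variable {N : Type} [AddCommGroup N] {Δ : SmoothFan N} {Y : NormalVariety}

/-- The pullback of functions on the torus to rational functions on `Y`, for a morphism that sends
the generic point into the torus. -/
noncomputable def genericHom (f : Y.carrier ⟶ Δ.toricVariety)
    (hf : genericPoint Y.carrier ∈ f ⁻¹ᵁ Δ.torus) :
    ChartRing (⊥ : PointedCone ℝ (RealSpace N)) →+* Y.carrier.functionField :=
  (Y.carrier.presheaf.germ (f ⁻¹ᵁ Δ.torus) _ hf).hom.comp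
    (pullChart f Δ.zeroCone (W := f ⁻¹ᵁ Δ.torus) le_rfl)

/-- The rational function defined by a function on a chart does not depend on the chart. -/
theorem germ_pullChart (f : Y.carrier ⟶ Δ.toricVariety)
    (hf : genericPoint Y.carrier ∈ f ⁻¹ᵁ Δ.torus) (σ : Δ.Cone) {W : Y.carrier.Opens}
    (h : W ≤ f ⁻¹ᵁ Δ.chartOpen σ) [Nonempty W] (a : ChartRing σ.1) :
    Y.carrier.germToFunctionField W (pullChart f σ h a) =
      genericHom f hf (chartRingMap (σ := σ.1) bot_le a) := by
  have hW : genericPoint Y.carrier ∈ W := Y.genericPoint_mem (Classical.arbitrary W).2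
  have : Nonempty (f ⁻¹ᵁ Δ.torus) := ⟨⟨_, hf⟩⟩
  have : Nonempty (W ⊓ f ⁻¹ᵁ Δ.torus : Y.carrier.Opens) := ⟨⟨_, hW, hf⟩⟩
  have hle : W ⊓ f ⁻¹ᵁ Δ.torus ≤ f ⁻¹ᵁ Δ.chartOpen Δ.zeroCone := inf_le_right
  refine (Y.germToFunctionField_map inf_le_left _).symm.trans
    ((congrArg _ ?_).trans (Y.germToFunctionField_map
      (inf_le_right : W ⊓ f ⁻¹ᵁ Δ.torus ≤ f ⁻¹ᵁ Δ.torus) _))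
  refine (map_pullChart f σ h inf_le_left a).trans (Eq.trans ?_
    (map_pullChart f Δ.zeroCone (W := f ⁻¹ᵁ Δ.torus) le_rfl hle _).symm)
  exact (pullChart_chartRingMap f (Δ.zeroCone_le σ) hle (inf_le_left.trans h) a).symm

theorem genericHom_algebraMap {f : Y.carrier ⟶ Δ.toricVariety}
    (hf : genericPoint Y.carrier ∈ f ⁻¹ᵁ Δ.torus) (hc : f ≫ Δ.toSpecℂ = Y.toSpecℂ) (c : ℂ) :
    genericHom f hf (algebraMap ℂ _ c) = Y.rationalConstants c := by
  obtain ⟨_, ⟨W, hW, rfl⟩, hy, hle⟩ :=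
    Y.carrier.isBasis_affineOpens.exists_subset_of_mem_open hf (f ⁻¹ᵁ Δ.torus).isOpen
  have : Nonempty W := ⟨⟨_, hy⟩⟩
  have h1 := germ_pullChart f hf Δ.zeroCone (W := W) hle (algebraMap ℂ _ c)
  have h2 : chartRingMap (σ := Δ.zeroCone.1) bot_le (algebraMap ℂ (ChartRing Δ.zeroCone.1) c) =
      algebraMap ℂ (ChartRing ⊥) c :=
    congrArg (fun k : ChartRing ⊥ →+* ChartRing ⊥ => k (algebraMap ℂ _ c))
      (chartRingMap_refl (⊥ : PointedCone ℝ (RealSpace N)))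
  rw [h2] at h1
  refine h1.symm.trans ((congrArg _ (pullChart_algebraMap hc Δ.zeroCone hW hle c)).trans ?_)
  exact Y.germToFunctionField_constants W c

end SmoothFan

namespace SmoothFan

/-! ### The divisor data of a morphism -/

open NormalVariety

section

variable {N : Type} [AddCommGroup N] {Δ : SmoothFan N} {Y : NormalVariety}

theorem germ_pullChart_torusMonomial (f : Y.carrier ⟶ Δ.toricVariety)
    (hf : genericPoint Y.carrier ∈ f ⁻¹ᵁ Δ.torus) {W : Y.carrier.Opens} [Nonempty W]
    (h : W ≤ f ⁻¹ᵁ Δ.chartOpen Δ.zeroCone) (m : DualLattice N) :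
    Y.carrier.germToFunctionField W (pullChart f Δ.zeroCone h (torusMonomial m)) =
      genericHom f hf (torusMonomial m) :=
  (germ_pullChart f hf Δ.zeroCone h (torusMonomial m)).trans
    (congrArg _ (chartRingMap_monomial (σ := Δ.zeroCone.1) bot_le ⟨m, mem_dualMonoid_bot m⟩))

theorem inverseImageMultiplicity_eq_zero_of_notMem (f : Y.carrier ⟶ Δ.toricVariety) {ρ : Δ.Ray}
    (P : Y.PrimeDivisor) (hP : f P.1 ∉ Δ.rayDivisor ρ) :
    inverseImageMultiplicity f (Δ.rayDivisor ρ) P = 0 := by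
  rw [inverseImageMultiplicity, idealStalk_eq_top_of_notMem hP, Ideal.map_top,
    Module.length_eq_zero_iff]
  exact Ideal.Quotient.subsingleton_iff.2 rfl

theorem pullChart_monomial_ne_zero (f : Y.carrier ⟶ Δ.toricVariety)
    (hf : genericPoint Y.carrier ∈ f ⁻¹ᵁ Δ.torus) (σ : Δ.Cone) {W : Y.carrier.Opens}
    (h : W ≤ f ⁻¹ᵁ Δ.chartOpen σ) [Nonempty W] (m : dualMonoid σ.1) :
    pullChart f σ h (monomial σ.1 m) ≠ 0 := by
  intro h0
  have h1 := germ_pullChart f hf σ h (monomial σ.1 m)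
  rw [h0, chartRingMap_monomial] at h1
  exact map_torusMonomial_ne_zero (genericHom f hf) m.1 (h1.symm.trans (map_zero _))

theorem mem_supp_iff {D : Y.WeilDivisor} {y : Y.carrier} :
    y ∈ D.supp ↔ ∃ P ∈ D.support, P.1 ⤳ y := by
  change y ∈ (⋃ P ∈ D.support, closure {P.1}) ↔ _
  simp only [Set.mem_iUnion, specializes_iff_mem_closure, exists_prop]

theorem mem_complement_iff {D : Δ.Ray → Y.WeilDivisor} {y : Y.carrier} :
    y ∈ complement D ↔ ∀ ρ, y ∉ (D ρ).supp := by
  change y ∈ (⋃ ρ, ((D ρ).supp : Set Y.carrier))ᶜ ↔ _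
  simp

theorem genericPoint_mem_preimage_torus (f : MorphismMeetingTorus Δ Y) :
    genericPoint Y.carrier ∈ f.hom ⁻¹ᵁ Δ.torus := by
  obtain ⟨_, ⟨y, rfl⟩, hy⟩ := f.meets
  exact Y.genericPoint_mem (W := f.hom ⁻¹ᵁ Δ.torus) hy

end

section

variable {N : Type} [AddCommGroup N] [Module.Free ℤ N] [Module.Finite ℤ N] {Δ : SmoothFan N}
  {Y : NormalVariety}

/-- The multiplicity of `f⁻¹(V(ρ))` along `P` is the order of vanishing of the pullback of the local
equation of `V(ρ)`. -/
theorem inverseImageMultiplicity_eq_ord (f : Y.carrier ⟶ Δ.toricVariety) {σ : Δ.Cone} {ρ : Δ.Ray}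
    (hρ : ρ.1 ≤ σ) {W : Y.carrier.Opens} (h : W ≤ f ⁻¹ᵁ Δ.chartOpen σ) (P : Y.PrimeDivisor)
    (hP : P.1 ∈ W) :
    inverseImageMultiplicity f (Δ.rayDivisor ρ) P =
      Ring.ord (Y.carrier.presheaf.stalk P.1)
        (Y.carrier.presheaf.germ W P.1 hP (pullChart f σ h (Δ.rayEquation hρ))) := by
  have h1 : (idealStalk (Scheme.IdealSheafData.vanishingIdeal (Δ.rayDivisor ρ)) (f P.1)).map
      (f.stalkMap P.1).hom =
      Ideal.span {Y.carrier.presheaf.germ W P.1 hP (pullChart f σ h (Δ.rayEquation hρ))} := by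
    rw [idealStalk_eq_map _ ⟨Δ.chartOpen σ, Δ.isAffineOpen_chartOpen σ⟩ (f P.1) (h hP),
      vanishingIdeal_rayDivisor Δ hρ, Ideal.map_span, Set.image_singleton, Ideal.map_span,
      Set.image_singleton]
    congr 2
    refine (Scheme.Hom.germ_stalkMap_apply f (Δ.chartOpen σ) P.1 (h hP) _).trans ?_
    exact (TopCat.Presheaf.germ_res_apply Y.carrier.presheaf (homOfLE h) P.1 hP _).symm
  rw [inverseImageMultiplicity, h1]
  rfl

theorem inverseImageMultiplicity_ne_zero (f : Y.carrier ⟶ Δ.toricVariety) {ρ : Δ.Ray}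
    (P : Y.PrimeDivisor) (hP : f P.1 ∈ Δ.rayDivisor ρ) :
    inverseImageMultiplicity f (Δ.rayDivisor ρ) P ≠ 0 := by
  obtain ⟨σ, hσ⟩ := Δ.exists_mem_chartOpen (f P.1)
  have hρ : ρ.1 ≤ σ := mem_raysOf.1 (Δ.raysThrough_subset hσ (mem_raysThrough.2 hP))
  have hle : f ⁻¹ᵁ Δ.chartOpen σ ≤ f ⁻¹ᵁ Δ.chartOpen σ := le_rfl
  rw [inverseImageMultiplicity_eq_ord f hρ hle P hσ]
  intro h0
  refine (mem_rayDivisor_iff_notMem_basicOpen f hρ hle hσ).1 hP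
    ((Scheme.mem_basicOpen Y.carrier _ P.1 hσ).2 ?_)
  rw [Ring.ord, Module.length_eq_zero_iff, Ideal.Quotient.subsingleton_iff,
    Ideal.span_singleton_eq_top] at h0
  exact h0

theorem inverseImageMultiplicity_ne_top (f : Y.carrier ⟶ Δ.toricVariety)
    (hf : genericPoint Y.carrier ∈ f ⁻¹ᵁ Δ.torus) (ρ : Δ.Ray) (P : Y.PrimeDivisor) :
    inverseImageMultiplicity f (Δ.rayDivisor ρ) P ≠ ⊤ := by
  by_cases hP : f P.1 ∈ Δ.rayDivisor ρ
  · obtain ⟨σ, hσ⟩ := Δ.exists_mem_chartOpen (f P.1)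
    have hρ : ρ.1 ≤ σ := mem_raysOf.1 (Δ.raysThrough_subset hσ (mem_raysThrough.2 hP))
    have hle : f ⁻¹ᵁ Δ.chartOpen σ ≤ f ⁻¹ᵁ Δ.chartOpen σ := le_rfl
    have : Nonempty (f ⁻¹ᵁ Δ.chartOpen σ) := ⟨⟨_, hσ⟩⟩
    rw [inverseImageMultiplicity_eq_ord f hρ hle P hσ]
    refine Ring.ord_ne_top (mem_nonZeroDivisors_of_ne_zero fun h0 => ?_)
    exact pullChart_monomial_ne_zero f hf σ hle _
      (germ_injective_of_isIntegral Y.carrier P.1 hσ (h0.trans (map_zero _).symm))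
  · rw [inverseImageMultiplicity_eq_zero_of_notMem f P hP]
    exact ENat.zero_ne_top

theorem characterOrd_dualVector (f : Y.carrier ⟶ Δ.toricVariety)
    (hf : genericPoint Y.carrier ∈ f ⁻¹ᵁ Δ.torus) {σ : Δ.Cone} {ρ : Δ.Ray} (hρ : ρ.1 ≤ σ)
    (P : Y.PrimeDivisor) (hP : f P.1 ∈ Δ.chartOpen σ) :
    Y.characterOrd (genericHom f hf) P (Δ.dualVector σ ρ) =
      (inverseImageMultiplicity f (Δ.rayDivisor ρ) P).toNat := by
  have hle : f ⁻¹ᵁ Δ.chartOpen σ ≤ f ⁻¹ᵁ Δ.chartOpen σ := le_rfl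
  have : Nonempty (f ⁻¹ᵁ Δ.chartOpen σ) := ⟨⟨_, hP⟩⟩
  have h1 := germ_pullChart f hf σ hle (Δ.rayEquation hρ)
  have h2 : chartRingMap (σ := σ.1) bot_le (Δ.rayEquation hρ) =
    torusMonomial (Δ.dualVector σ ρ) := chartRingMap_monomial _ _
  rw [h2, ← Scheme.algebraMap_germ_eq_germToFunctionField Y.carrier (x := P.1) hP] at h1
  rw [inverseImageMultiplicity_eq_ord f hρ hle P hP, ← ord_algebraMap Y P]
  · exact congrArg (fun g => Scheme.ord g P.1) h1.symm
  · intro h0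
    exact pullChart_monomial_ne_zero f hf σ hle _
      (germ_injective_of_isIntegral Y.carrier P.1 hP (h0.trans (map_zero _).symm))

/-- The divisor of the pullback of the character `e(m)`. -/
theorem characterOrd_genericHom (f : Y.carrier ⟶ Δ.toricVariety)
    (hf : genericPoint Y.carrier ∈ f ⁻¹ᵁ Δ.torus) (P : Y.PrimeDivisor) (m : DualLattice N) :
    Y.characterOrd (genericHom f hf) P m =
      ∑ ρ, m (Δ.primitiveGenerator ρ) *
        ((inverseImageMultiplicity f (Δ.rayDivisor ρ) P).toNat : ℤ) := by
  obtain ⟨σ, hσ⟩ := Δ.exists_mem_chartOpen (f P.1)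
  have : Nonempty (f ⁻¹ᵁ Δ.chartOpen σ) := ⟨⟨_, hσ⟩⟩
  have hle : f ⁻¹ᵁ Δ.chartOpen σ ≤ f ⁻¹ᵁ Δ.chartOpen σ := le_rfl
  rw [Δ.addMonoidHom_eq_sum σ _ fun m hm => ?_]
  · rw [← Finset.sum_subset (Finset.subset_univ (Δ.raysOf σ)) fun ρ _ hρ => ?_]
    · exact Finset.sum_congr rfl fun ρ hρ => by
        rw [characterOrd_dualVector f hf (mem_raysOf.1 hρ) P hσ]
    · rw [inverseImageMultiplicity_eq_zero_of_notMem f P fun h =>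
        hρ (Δ.raysThrough_subset hσ (mem_raysThrough.2 h))]
      simp
  · have h1 := germ_pullChart f hf σ hle (monomial σ.1 ⟨m, hm⟩)
    rw [chartRingMap_monomial] at h1
    have h2 := Y.ord_germ_nonneg P (W := f ⁻¹ᵁ Δ.chartOpen σ) hσ
      (pullChart f σ hle (monomial σ.1 ⟨m, hm⟩))
    rw [h1] at h2
    exact h2

theorem finite_mem_rayDivisor (f : Y.carrier ⟶ Δ.toricVariety)
    (hf : genericPoint Y.carrier ∈ f ⁻¹ᵁ Δ.torus) (ρ : Δ.Ray) :
    {P : Y.PrimeDivisor | f P.1 ∈ Δ.rayDivisor ρ}.Finite :=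
  Y.finite_primeDivisor_of_isClosed ((Δ.rayDivisor ρ).isClosed.preimage f.continuous)
    ((Δ.mem_torus_iff).1 hf ρ)

/-- The pullback of the divisor `V(ρ)`. -/
noncomputable def pullbackDivisor (f : Y.carrier ⟶ Δ.toricVariety)
    (hf : genericPoint Y.carrier ∈ f ⁻¹ᵁ Δ.torus) (ρ : Δ.Ray) : Y.WeilDivisor :=
  Finsupp.onFinset (finite_mem_rayDivisor f hf ρ).toFinset
    (fun P => ((inverseImageMultiplicity f (Δ.rayDivisor ρ) P).toNat : ℤ)) fun P hP => by
      rw [Set.Finite.mem_toFinset]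
      by_contra h
      refine hP ?_
      rw [inverseImageMultiplicity_eq_zero_of_notMem f P h]
      rfl

theorem pullbackDivisor_apply (f : Y.carrier ⟶ Δ.toricVariety)
    (hf : genericPoint Y.carrier ∈ f ⁻¹ᵁ Δ.torus) (ρ : Δ.Ray) (P : Y.PrimeDivisor) :
    pullbackDivisor f hf ρ P = (inverseImageMultiplicity f (Δ.rayDivisor ρ) P).toNat := rfl

theorem mem_support_pullbackDivisor (f : Y.carrier ⟶ Δ.toricVariety)
    (hf : genericPoint Y.carrier ∈ f ⁻¹ᵁ Δ.torus) (ρ : Δ.Ray) (P : Y.PrimeDivisor) :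
    P ∈ (pullbackDivisor f hf ρ).support ↔ f P.1 ∈ Δ.rayDivisor ρ := by
  rw [Finsupp.mem_support_iff, pullbackDivisor_apply]
  constructor
  · intro h
    by_contra h0
    rw [inverseImageMultiplicity_eq_zero_of_notMem f P h0] at h
    exact h rfl
  · intro h h0
    have h1 := Int.natCast_eq_zero.1 h0
    rw [ENat.toNat_eq_zero] at h1
    exact h1.elim (inverseImageMultiplicity_ne_zero f P h)
      (inverseImageMultiplicity_ne_top f hf ρ P)

/-- The support of the pullback of `V(ρ)` is the preimage of `V(ρ)`. -/
theorem mem_supp_pullbackDivisor (f : Y.carrier ⟶ Δ.toricVariety)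
    (hf : genericPoint Y.carrier ∈ f ⁻¹ᵁ Δ.torus) (ρ : Δ.Ray) (y : Y.carrier) :
    y ∈ (pullbackDivisor f hf ρ).supp ↔ f y ∈ Δ.rayDivisor ρ := by
  rw [mem_supp_iff]
  constructor
  · rintro ⟨P, hP, hPy⟩
    rw [mem_support_pullbackDivisor] at hP
    exact (hPy.map f.continuous).mem_closed (Δ.rayDivisor ρ).isClosed hP
  · intro hy
    obtain ⟨σ, hσ⟩ := Δ.exists_mem_chartOpen (f y)
    have hρ : ρ.1 ≤ σ := mem_raysOf.1 (Δ.raysThrough_subset hσ (mem_raysThrough.2 hy))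
    obtain ⟨_, ⟨W, hW, rfl⟩, hyW, hle⟩ := Y.carrier.isBasis_affineOpens.exists_subset_of_mem_open
      (show y ∈ (f ⁻¹ᵁ Δ.chartOpen σ : Set Y.carrier) from hσ) (f ⁻¹ᵁ Δ.chartOpen σ).isOpen
    have : Nonempty W := ⟨⟨_, hyW⟩⟩
    rw [mem_rayDivisor_iff_notMem_basicOpen f hρ hle hyW] at hy
    obtain ⟨P, hPy, hPW, hP⟩ := Y.exists_primeDivisor_of_notMem_basicOpen hW
      (pullChart_monomial_ne_zero f hf σ hle _) hyW hy
    exact ⟨P, (mem_support_pullbackDivisor f hf ρ P).2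
      ((mem_rayDivisor_iff_notMem_basicOpen f hρ hle hPW).2 hP), hPy⟩

theorem preimage_torus_eq_complement (f : Y.carrier ⟶ Δ.toricVariety)
    (hf : genericPoint Y.carrier ∈ f ⁻¹ᵁ Δ.torus) :
    f ⁻¹ᵁ Δ.torus = complement (pullbackDivisor f hf) := by
  ext y
  change f y ∈ Δ.torus ↔ y ∈ complement (pullbackDivisor f hf)
  rw [mem_torus_iff, mem_complement_iff]
  simp only [mem_supp_pullbackDivisor]

theorem complement_le_preimage (f : Y.carrier ⟶ Δ.toricVariety)
    (hf : genericPoint Y.carrier ∈ f ⁻¹ᵁ Δ.torus) :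
    complement (pullbackDivisor f hf) ≤ f ⁻¹ᵁ Δ.chartOpen Δ.zeroCone :=
  (preimage_torus_eq_complement f hf).ge

/-- The pullbacks of the characters, as a homomorphism from `M` to the units on the complement of
the pulled back divisors. -/
noncomputable def pullCharacters (f : Y.carrier ⟶ Δ.toricVariety)
    (hf : genericPoint Y.carrier ∈ f ⁻¹ᵁ Δ.torus) :
    Multiplicative (DualLattice N) →* Γ(Y.carrier, complement (pullbackDivisor f hf))ˣ :=
  MonoidHom.toHomUnits
    ((pullChart f Δ.zeroCone (complement_le_preimage f hf)).toMonoidHom.comp torusMonomialHom)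

theorem coe_pullCharacters (f : Y.carrier ⟶ Δ.toricVariety)
    (hf : genericPoint Y.carrier ∈ f ⁻¹ᵁ Δ.torus) (m : DualLattice N) :
    (pullCharacters f hf (.ofAdd m) : Γ(Y.carrier, complement (pullbackDivisor f hf))) =
      pullChart f Δ.zeroCone (complement_le_preimage f hf) (torusMonomial m) := rfl

theorem div_pullCharacters (f : Y.carrier ⟶ Δ.toricVariety)
    (hf : genericPoint Y.carrier ∈ f ⁻¹ᵁ Δ.torus) (m : DualLattice N) :
    NormalVariety.div (pullCharacters f hf (.ofAdd m) :
      Γ(Y.carrier, complement (pullbackDivisor f hf))) =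
        ⇑(∑ ρ, m (Δ.primitiveGenerator ρ) • pullbackDivisor f hf ρ) := by
  funext P
  rw [NormalVariety.div, coe_pullCharacters, germ_pullChart_torusMonomial f hf,
    Finsupp.finsetSum_apply]
  exact characterOrd_genericHom f hf P m

/-- The pair `(D, ε)` attached to a morphism. -/
noncomputable def MorphismMeetingTorus.divisorData (f : MorphismMeetingTorus Δ Y) :
    DivisorData Δ Y where
  D := pullbackDivisor f.hom (genericPoint_mem_preimage_torus f)
  effective ρ P := by
    rw [pullbackDivisor_apply]
    exact Int.natCast_nonneg _
  iInter_supp A hA := by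
    rw [Set.eq_empty_iff_forall_notMem]
    intro y hy
    rw [Set.mem_iInter₂] at hy
    obtain ⟨σ, hσ⟩ := Δ.exists_mem_chartOpen (f.hom y)
    exact hA (Δ.iSup_rays_mem σ fun ρ hρ => Δ.raysThrough_subset hσ (mem_raysThrough.2
      ((mem_supp_pullbackDivisor f.hom (genericPoint_mem_preimage_torus f) ρ y).1 (hy ρ hρ))))
  ε := pullCharacters f.hom (genericPoint_mem_preimage_torus f)
  div_ε m := div_pullCharacters f.hom (genericPoint_mem_preimage_torus f) m

theorem corresponds_divisorData (f : MorphismMeetingTorus Δ Y) :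
    Corresponds f f.divisorData where
  multiplicity ρ P :=
    (ENat.natCast_toNat
      (inverseImageMultiplicity_ne_top f.hom (genericPoint_mem_preimage_torus f) ρ P)).symm
  preimage_torus := preimage_torus_eq_complement f.hom (genericPoint_mem_preimage_torus f)
  ε_eq _ := rfl

theorem DivisorData.ext_of_forall {d d' : DivisorData Δ Y} (hD : d.D = d'.D)
    (hε : ∀ m, Y.carrier.germToFunctionField _
      (d.ε m : Γ(Y.carrier, complement d.D)) =
        Y.carrier.germToFunctionField _ (d'.ε m : Γ(Y.carrier, complement d'.D))) : d = d' := by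
  obtain ⟨D, _, _, ε, _⟩ := d
  obtain ⟨D', _, _, ε', _⟩ := d'
  obtain rfl : D = D' := hD
  congr
  ext m
  exact Scheme.germToFunctionField_injective Y.carrier _ (hε m)

/-- As a rational function, `ε(m)` is the pullback of the character `e(m)`. -/
theorem Corresponds.germ_ε {f : MorphismMeetingTorus Δ Y} {d : DivisorData Δ Y}
    (h : Corresponds f d) (m : DualLattice N) :
    Y.carrier.germToFunctionField _ (d.ε (.ofAdd m) : Γ(Y.carrier, complement d.D)) =
      genericHom f.hom (genericPoint_mem_preimage_torus f) (torusMonomial m) := by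
  rw [h.ε_eq]
  exact germ_pullChart_torusMonomial f.hom (genericPoint_mem_preimage_torus f)
    (W := complement d.D) h.preimage_torus.ge m

theorem Corresponds.D_eq {f : MorphismMeetingTorus Δ Y} {d : DivisorData Δ Y}
    (h : Corresponds f d) :
    d.D = pullbackDivisor f.hom (genericPoint_mem_preimage_torus f) := by
  funext ρ
  ext P
  rw [pullbackDivisor_apply, h.multiplicity ρ P, ENat.toNat_natCast]
  exact (Int.toNat_of_nonneg (d.effective ρ P)).symm

theorem divisorData_eq_iff_corresponds {f : MorphismMeetingTorus Δ Y} {d : DivisorData Δ Y} :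
    f.divisorData = d ↔ Corresponds f d := by
  constructor
  · rintro rfl
    exact corresponds_divisorData f
  · intro h
    have h' := corresponds_divisorData f
    exact DivisorData.ext_of_forall (h'.D_eq.trans h.D_eq.symm) fun m =>
      (h'.germ_ε m.toAdd).trans (h.germ_ε m.toAdd).symm

end

end SmoothFan

namespace SmoothFan

open NormalVariety

/-! ### A morphism is determined by its divisor data -/

variable {N : Type} [AddCommGroup N] [Module.Free ℤ N] [Module.Finite ℤ N] {Δ : SmoothFan N}
  {Y : NormalVariety}

/-- Two morphisms to the toric variety with the same preimages of the divisors `V(ρ)` send every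
point into a common chart, and so agree when they induce the same rational functions. -/
theorem hom_ext_of_genericHom {f f' : Y.carrier ⟶ Δ.toricVariety}
    (hf : genericPoint Y.carrier ∈ f ⁻¹ᵁ Δ.torus) (hf' : genericPoint Y.carrier ∈ f' ⁻¹ᵁ Δ.torus)
    (h : ∀ ρ y, f y ∈ Δ.rayDivisor ρ ↔ f' y ∈ Δ.rayDivisor ρ)
    (hθ : genericHom f hf = genericHom f' hf') : f = f' := by
  refine Scheme.hom_ext_of_forall f f' fun y => ?_
  have hrays : Δ.raysThrough (f y) = Δ.raysThrough (f' y) := by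
    ext ρ
    rw [mem_raysThrough, mem_raysThrough, h ρ y]
  let τ : Δ.Cone := ⟨_, Δ.iSup_raysThrough_mem (f y)⟩
  have hy : f y ∈ Δ.chartOpen τ := Δ.mem_chartOpen_of_eq_iSup rfl
  have hy' : f' y ∈ Δ.chartOpen τ := Δ.mem_chartOpen_of_eq_iSup (by rw [← hrays])
  obtain ⟨_, ⟨W, hW, rfl⟩, hyW, hle⟩ := Y.carrier.isBasis_affineOpens.exists_subset_of_mem_open
    (show y ∈ (f ⁻¹ᵁ Δ.chartOpen τ ⊓ f' ⁻¹ᵁ Δ.chartOpen τ : Y.carrier.Opens) from ⟨hy, hy'⟩)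
    (f ⁻¹ᵁ Δ.chartOpen τ ⊓ f' ⁻¹ᵁ Δ.chartOpen τ).isOpen
  have : Nonempty W := ⟨⟨_, hyW⟩⟩
  have hle₁ : W ≤ f ⁻¹ᵁ Δ.chartOpen τ := fun z hz => (hle hz).1
  have hle₂ : W ≤ f' ⁻¹ᵁ Δ.chartOpen τ := fun z hz => (hle hz).2
  refine ⟨W, hyW, ?_⟩
  rw [ι_comp_eq_homOfRingHom f τ hle₁, ι_comp_eq_homOfRingHom f' τ hle₂]
  refine congrArg _ (RingHom.ext fun a => ?_)
  apply Scheme.germToFunctionField_injective Y.carrier W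
  rw [germ_pullChart f hf, germ_pullChart f' hf', hθ]

theorem divisorData_injective :
    Function.Injective (MorphismMeetingTorus.divisorData : MorphismMeetingTorus Δ Y → _) := by
  intro f f' h
  have h1 := corresponds_divisorData f
  have h2 : Corresponds f' f.divisorData := by
    rw [h]
    exact corresponds_divisorData f'
  have hhom : f.hom = f'.hom := by
    refine hom_ext_of_genericHom (genericPoint_mem_preimage_torus f)
      (genericPoint_mem_preimage_torus f') (fun ρ y => ?_) (ringHom_ext ?_ fun m => ?_)
    · rw [← mem_supp_pullbackDivisor f.hom (genericPoint_mem_preimage_torus f),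
        ← mem_supp_pullbackDivisor f'.hom (genericPoint_mem_preimage_torus f'),
        ← h1.D_eq, ← h2.D_eq]
    · ext1 c
      exact (genericHom_algebraMap _ f.comp_toSpecℂ c).trans
        (genericHom_algebraMap _ f'.comp_toSpecℂ c).symm
    · exact (h1.germ_ε m.1).symm.trans (h2.germ_ε m.1)
  obtain ⟨f, _, _⟩ := f
  obtain ⟨f', _, _⟩ := f'
  obtain rfl : f = f' := hhom
  rfl

end SmoothFan

/-! ### Construction of a morphism from its divisor data -/

/-- A ring homomorphism with values in the range of an injective one factors through it. -/
theorem exists_ringHom_comp {A B K : Type*} [CommRing A] [CommRing B] [CommRing K] (g : B →+* K)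
    (hg : Function.Injective g) (h : A →+* K) (hh : ∀ a, h a ∈ Set.range g) :
    ∃ φ : A →+* B, ∀ a, g (φ a) = h a := by
  choose φ hφ using hh
  refine ⟨{ toFun := φ, map_one' := hg ?_, map_mul' := fun x y => hg ?_, map_zero' := hg ?_,
            map_add' := fun x y => hg ?_ }, hφ⟩
  · rw [hφ, map_one, map_one]
  · rw [map_mul, hφ, hφ, hφ, map_mul]
  · rw [hφ, map_zero, map_zero]
  · rw [map_add, hφ, hφ, hφ, map_add]

/-- Morphisms on the members of an open cover that agree on the pairwise intersections glue. -/
theorem exists_glue {S X : Scheme.{0}} {ι : Type} (W : ι → S.Opens) (hW : IsOpenCover W)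
    (g : ∀ i, (W i).toScheme ⟶ X)
    (h : ∀ i j, S.homOfLE (inf_le_left : W i ⊓ W j ≤ W i) ≫ g i =
      S.homOfLE (inf_le_right : W i ⊓ W j ≤ W j) ≫ g j) :
    ∃ f : S ⟶ X, ∀ i, (W i).ι ≫ f = g i := by
  have hcompat : ∀ i j, pullback.fst (W i).ι (W j).ι ≫ g i = pullback.snd _ _ ≫ g j := by
    intro i j
    have hp := IsOpenImmersion.isPullback (S.homOfLE (inf_le_left : W i ⊓ W j ≤ W i))
      (S.homOfLE inf_le_right) (W i).ι (W j).ι (by simp)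
      (by ext x; simp [show (W j).ι x ∈ W j from x.2])
    rw [← cancel_epi hp.isoPullback.hom, IsPullback.isoPullback_hom_fst_assoc,
      IsPullback.isoPullback_hom_snd_assoc, h]
  exact ⟨(S.openCoverOfIsOpenCover W hW).glueMorphisms g hcompat,
    (S.openCoverOfIsOpenCover W hW).ι_glueMorphisms g hcompat⟩

theorem NormalVariety.isAffineOpen_inf (Y : NormalVariety) {U V : Y.carrier.Opens}
    (hU : IsAffineOpen U) (hV : IsAffineOpen V) : IsAffineOpen (U ⊓ V) := by
  have h : terminal.from Y.carrier = Y.toSpecℂ ≫ terminal.from _ := Subsingleton.elim _ _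
  have : IsSeparated (terminal.from Y.carrier) := by
    rw [h]
    infer_instance
  exact hU.inf hV

namespace SmoothFan

namespace DivisorData

open NormalVariety

variable {N : Type} [AddCommGroup N] [Module.Free ℤ N] [Module.Finite ℤ N] {Δ : SmoothFan N}
  {Y : NormalVariety} (d : DivisorData Δ Y)

/-- The homomorphism from the coordinate ring of the torus to the function field of `Y` given
by `ε`. -/
noncomputable def genericHom :
    ChartRing (⊥ : PointedCone ℝ (RealSpace N)) →+* Y.carrier.functionField :=
  AddMonoidAlgebra.liftNCRingHom Y.rationalConstants
    { toFun := fun m => Y.carrier.germToFunctionField _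
        (d.ε (.ofAdd m.toAdd.1) : Γ(Y.carrier, complement d.D))
      map_one' := by
        refine (congrArg (fun u : Γ(Y.carrier, complement d.D)ˣ =>
          Y.carrier.germToFunctionField _ (u : Γ(Y.carrier, complement d.D)))
          (d.ε.map_one)).trans ?_
        exact map_one _
      map_mul' := fun m m' => by
        refine (congrArg (fun u : Γ(Y.carrier, complement d.D)ˣ =>
          Y.carrier.germToFunctionField _ (u : Γ(Y.carrier, complement d.D)))
          (d.ε.map_mul (.ofAdd m.toAdd.1) (.ofAdd m'.toAdd.1))).trans ?_
        exact map_mul _ _ _ }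
    fun _ _ => Commute.all _ _

theorem genericHom_torusMonomial (m : DualLattice N) :
    d.genericHom (torusMonomial m) =
      Y.carrier.germToFunctionField _ (d.ε (.ofAdd m) : Γ(Y.carrier, complement d.D)) := by
  refine (AddMonoidAlgebra.liftNCRingHom_single _ _ _ _ _).trans ?_
  rw [map_one, one_mul]
  rfl

theorem genericHom_algebraMap (c : ℂ) :
    d.genericHom (algebraMap ℂ _ c) = Y.rationalConstants c := by
  refine (AddMonoidAlgebra.liftNCRingHom_single _ _ _ _ _).trans ?_
  refine (congrArg (Y.rationalConstants c * ·) (map_one _)).trans ?_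
  rw [mul_one]

theorem characterOrd_genericHom (P : Y.PrimeDivisor) (m : DualLattice N) :
    Y.characterOrd d.genericHom P m = ∑ ρ, m (Δ.primitiveGenerator ρ) * d.D ρ P := by
  refine (congrArg (fun g => Scheme.ord g P.1) (d.genericHom_torusMonomial m)).trans ?_
  refine (congrFun (d.div_ε m) P).trans ?_
  rw [Finsupp.finsetSum_apply]
  rfl

/-- The open set of the points that lie on no `D(ρ)` with `ρ` outside the cone `σ`. It is the
preimage of the chart `U_σ` under the morphism to be constructed. -/
def chartDomain (σ : Δ.Cone) : Y.carrier.Opens where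
  carrier := ⋂ ρ ∈ {ρ : Δ.Ray | ¬ ρ.1 ≤ σ}, ((d.D ρ).supp : Set Y.carrier)ᶜ
  is_open' := Set.Finite.isOpen_biInter (Set.toFinite _) fun ρ _ =>
    (d.D ρ).supp.isClosed.isOpen_compl

theorem mem_chartDomain {σ : Δ.Cone} {y : Y.carrier} :
    y ∈ d.chartDomain σ ↔ ∀ ρ : Δ.Ray, y ∈ (d.D ρ).supp → ρ.1 ≤ σ := by
  change y ∈ (⋂ ρ ∈ {ρ : Δ.Ray | ¬ ρ.1 ≤ σ}, ((d.D ρ).supp : Set Y.carrier)ᶜ) ↔ _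
  simp only [Set.mem_iInter, Set.mem_ofPred_eq, Set.mem_compl_iff]
  exact forall_congr' fun ρ => not_imp_not

open Classical in
/-- The cone spanned by the rays `ρ` with `y ∈ D(ρ)`. -/
noncomputable def coneAt (y : Y.carrier) : Δ.Cone :=
  ⟨⨆ ρ ∈ Finset.univ.filter fun ρ => y ∈ (d.D ρ).supp, ρ.1.1, by
    by_contra h
    have h1 : y ∈ ⋂ ρ ∈ Finset.univ.filter fun ρ => y ∈ (d.D ρ).supp,
        ((d.D ρ).supp : Set Y.carrier) := by
      simp
    rw [d.iInter_supp _ h] at h1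
    exact h1⟩

theorem mem_chartDomain_coneAt (y : Y.carrier) : y ∈ d.chartDomain (d.coneAt y) := by
  classical
  rw [mem_chartDomain]
  intro ρ hρ
  exact le_iSup₂_of_le (f := fun (ρ : Δ.Ray) (_ : ρ ∈ Finset.univ.filter
    fun ρ => y ∈ (d.D ρ).supp) => ρ.1.1) ρ (by simpa using hρ) le_rfl

theorem coneAt_genericPoint : (d.coneAt (genericPoint Y.carrier)).1 = ⊥ := by
  classical
  have h := genericPoint_mem_complement d.D
  rw [mem_complement_iff] at h
  simp [coneAt, h]

theorem apply_eq_zero {P : Y.PrimeDivisor} {σ : Δ.Cone} (hP : P.1 ∈ d.chartDomain σ) {ρ : Δ.Ray}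
    (hρ : ¬ ρ.1 ≤ σ) : d.D ρ P = 0 := by
  by_contra h
  exact hρ ((d.mem_chartDomain).1 hP ρ
    (mem_supp_iff.2 ⟨P, Finsupp.mem_support_iff.2 h, specializes_rfl⟩))

theorem characterOrd_nonneg {P : Y.PrimeDivisor} {σ : Δ.Cone} (hP : P.1 ∈ d.chartDomain σ)
    {m : DualLattice N} (hm : m ∈ dualMonoid σ.1) : 0 ≤ Y.characterOrd d.genericHom P m := by
  rw [characterOrd_genericHom]
  refine Finset.sum_nonneg fun ρ _ => ?_
  by_cases hρ : ρ.1 ≤ σ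
  · exact mul_nonneg ((Δ.mem_dualMonoid_iff σ m).1 hm ρ hρ) (d.effective ρ P)
  · rw [d.apply_eq_zero hP hρ, mul_zero]

/-- The functions on the chart `U_σ` pull back to regular functions on the affine open subsets of
its prospective preimage. -/
theorem exists_ringHom (σ : Δ.Cone) {W : Y.carrier.Opens} [Nonempty W] (hW : IsAffineOpen W)
    (hle : W ≤ d.chartDomain σ) : ∃ φ : ChartRing σ.1 →+* Γ(Y.carrier, W),
      ∀ a, Y.carrier.germToFunctionField W (φ a) =
        d.genericHom (chartRingMap (σ := σ.1) bot_le a) := by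
  refine exists_ringHom_comp (Y.carrier.germToFunctionField W).hom
    (Scheme.germToFunctionField_injective Y.carrier W)
    (d.genericHom.comp (chartRingMap (σ := σ.1) bot_le)) fun a => ?_
  change _ ∈ (Y.carrier.germToFunctionField W).hom.range
  induction a using AddMonoidAlgebra.induction_linear with
  | zero => exact ⟨0, by rw [RingHom.map_zero, RingHom.map_zero]⟩
  | add x y hx hy =>
    rw [RingHom.map_add]
    exact Subring.add_mem _ hx hy
  | single m c =>
    have h1 : (AddMonoidAlgebra.single m c : ChartRing σ.1) =
        algebraMap ℂ (ChartRing σ.1) c * monomial σ.1 m := by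
      rw [monomial]
      exact ((AddMonoidAlgebra.single_mul_single 0 m c 1).trans (by rw [zero_add, mul_one])).symm
    rw [h1, RingHom.map_mul]
    refine Subring.mul_mem _ ⟨constants Y.toSpecℂ W c, ?_⟩ ?_
    · refine (Y.germToFunctionField_constants W c).trans ?_
      rw [← d.genericHom_algebraMap c]
      exact congrArg d.genericHom (chartRingMap_single (τ := ⊥) bot_le 0 c).symm
    · rw [RingHom.comp_apply, chartRingMap_monomial]
      refine Y.mem_range_germToFunctionField hW _ fun P hP => ?_
      exact Y.mem_range_of_ord_nonneg P (map_torusMonomial_ne_zero d.genericHom m.1)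
        (d.characterOrd_nonneg (hle hP) m.2)

theorem exists_affine_nhd (y : Y.carrier) :
    ∃ W : Y.carrier.Opens, IsAffineOpen W ∧ y ∈ W ∧ W ≤ d.chartDomain (d.coneAt y) := by
  obtain ⟨_, ⟨W, hW, rfl⟩, hyW, hle⟩ := Y.carrier.isBasis_affineOpens.exists_subset_of_mem_open
    (d.mem_chartDomain_coneAt y) (d.chartDomain (d.coneAt y)).isOpen
  exact ⟨W, hW, hyW, hle⟩

/-- The local morphisms glue, and the resulting morphism induces the rational functions given
by `ε`. -/
theorem exists_hom : ∃ f : Y.carrier ⟶ Δ.toricVariety, f ≫ Δ.toSpecℂ = Y.toSpecℂ ∧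
    (∀ y, f y ∈ Δ.chartOpen (d.coneAt y)) ∧
    ∀ hf : genericPoint Y.carrier ∈ f ⁻¹ᵁ Δ.torus, ∀ m,
      SmoothFan.genericHom f hf (torusMonomial m) = d.genericHom (torusMonomial m) := by
  choose W hW hyW hle using d.exists_affine_nhd
  have hne : ∀ y, Nonempty (W y) := fun y => ⟨⟨_, hyW y⟩⟩
  choose φ hφ using fun y => d.exists_ringHom (d.coneAt y) (hW y) (hle y)
  let g : ∀ y, (W y).toScheme ⟶ Δ.toricVariety := fun y => Δ.homOfRingHom (d.coneAt y) (φ y)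
  have hcov : IsOpenCover W := by
    refine eq_top_iff.2 fun y _ => ?_
    exact Opens.mem_iSup.2 ⟨y, hyW y⟩
  -- On an intersection both local morphisms come from the chart of the intersection of the cones.
  have hglue : ∀ y y', Y.carrier.homOfLE (inf_le_left : W y ⊓ W y' ≤ W y) ≫ g y =
      Y.carrier.homOfLE (inf_le_right : W y ⊓ W y' ≤ W y') ≫ g y' := by
    intro y y'
    let τ : Δ.Cone := ⟨(d.coneAt y).1 ⊓ (d.coneAt y').1, Δ.face_mem _ (d.coneAt y).2 _
      (Δ.inter_isFaceOf _ (d.coneAt y).2 _ (d.coneAt y').2)⟩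
    have hτ : τ ≤ d.coneAt y := (inf_le_left : (d.coneAt y).1 ⊓ (d.coneAt y').1 ≤ _)
    have hτ' : τ ≤ d.coneAt y' := (inf_le_right : (d.coneAt y).1 ⊓ (d.coneAt y').1 ≤ _)
    have hgen : genericPoint Y.carrier ∈ W y ⊓ W y' :=
      ⟨Y.genericPoint_mem (hyW y), Y.genericPoint_mem (hyW y')⟩
    have : Nonempty (W y ⊓ W y' : Y.carrier.Opens) := ⟨⟨_, hgen⟩⟩
    have hdom : W y ⊓ W y' ≤ d.chartDomain τ := by
      intro z hz
      rw [mem_chartDomain]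
      exact fun ρ hρ => le_inf (α := PointedCone ℝ (RealSpace N))
        ((d.mem_chartDomain).1 (hle y hz.1) ρ hρ) ((d.mem_chartDomain).1 (hle y' hz.2) ρ hρ)
    obtain ⟨ψ, hψ⟩ := d.exists_ringHom τ (Y.isAffineOpen_inf (hW y) (hW y')) hdom
    have key : ∀ (z : Y.carrier) (i : W y ⊓ W y' ≤ W z) (hz : τ ≤ d.coneAt z),
        Y.carrier.homOfLE i ≫ g z = Δ.homOfRingHom τ ψ := by
      intro z i hz
      refine Δ.homOfLE_homOfRingHom hz i (φ z) ψ fun a => ?_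
      apply Scheme.germToFunctionField_injective Y.carrier (W y ⊓ W y')
      rw [Y.germToFunctionField_map i, hφ, hψ]
      refine congrArg d.genericHom ?_
      exact (congrArg (fun k : ChartRing (d.coneAt z).1 →+* ChartRing ⊥ => k a)
        (chartRingMap_comp (σ := (d.coneAt z).1) (τ := τ.1) hz bot_le)).symm
    rw [key y inf_le_left hτ, key y' inf_le_right hτ']
  obtain ⟨f, hf⟩ := exists_glue W hcov g hglue
  have hchart : ∀ y, W y ≤ f ⁻¹ᵁ Δ.chartOpen (d.coneAt y) := by
    intro y z hz
    let z' : (W y).toScheme := ⟨z, hz⟩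
    have h1 : f z = g y z' :=
      (Scheme.Hom.comp_apply (W y).ι f z').symm.trans (congrArg (fun k => k z') (hf y))
    have h2 : g y z' ∈ Δ.chartOpen (d.coneAt y) := Δ.homOfRingHom_mem _ _ _
    rw [← h1] at h2
    exact h2
  have hpull : ∀ y, pullChart f (d.coneAt y) (hchart y) = φ y := fun y =>
    Δ.homOfRingHom_injective (d.coneAt y) (hW y)
      ((ι_comp_eq_homOfRingHom f (d.coneAt y) (hchart y)).symm.trans (hf y))
  refine ⟨f, ?_, fun y => hchart y (hyW y), fun hgen m => ?_⟩
  · refine Scheme.hom_ext_of_forall _ _ fun y => ⟨W y, hyW y, ?_⟩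
    rw [← Category.assoc, hf, ← toSpecΓ_constants, homOfRingHom_toSpecℂ]
    congr 3
    ext1 c
    apply Scheme.germToFunctionField_injective Y.carrier (W y)
    rw [Y.germToFunctionField_constants]
    refine (hφ y _).trans ?_
    rw [← d.genericHom_algebraMap c]
    exact congrArg d.genericHom (chartRingMap_single (τ := ⊥) bot_le 0 c)
  · have hm : m ∈ dualMonoid (d.coneAt (genericPoint Y.carrier)).1 := by
      rw [coneAt_genericPoint]
      exact mem_dualMonoid_bot m
    have h1 := germ_pullChart f hgen _ (hchart (genericPoint Y.carrier)) (monomial _ ⟨m, hm⟩)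
    rw [hpull, hφ, chartRingMap_monomial] at h1
    exact h1.symm

/-- The glued morphism has the given divisor data: the multiplicity of `D(ρ)` along `P` is the order
of `ε` at the dual vector of `ρ` in the cone at `P`. -/
theorem exists_morphism : ∃ f : MorphismMeetingTorus Δ Y, f.divisorData = d := by
  obtain ⟨f, hc, hchart, hθ⟩ := d.exists_hom
  have hgen : genericPoint Y.carrier ∈ f ⁻¹ᵁ Δ.torus := by
    have h1 : d.coneAt (genericPoint Y.carrier) = Δ.zeroCone :=
      Subtype.ext d.coneAt_genericPoint
    have h2 := hchart (genericPoint Y.carrier)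
    rw [h1] at h2
    exact h2
  let F : MorphismMeetingTorus Δ Y := ⟨f, hc, ⟨_, ⟨_, rfl⟩, hgen⟩⟩
  refine ⟨F, DivisorData.ext_of_forall ?_ fun m => ?_⟩
  · funext ρ
    ext P
    change pullbackDivisor f hgen ρ P = d.D ρ P
    rw [pullbackDivisor_apply]
    have hP := hchart P.1
    by_cases hρ : ρ.1 ≤ d.coneAt P.1
    · rw [← characterOrd_dualVector f hgen hρ P hP]
      refine (congrArg (fun g => Scheme.ord g P.1) (hθ hgen _)).trans ?_
      refine (d.characterOrd_genericHom P _).trans ?_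
      rw [Finset.sum_eq_single ρ, Δ.dualVector_self hρ, one_mul]
      · intro ρ' _ hne
        by_cases hρ' : ρ'.1 ≤ d.coneAt P.1
        · rw [Δ.dualVector_of_ne hρ hρ' hne.symm, zero_mul]
        · rw [d.apply_eq_zero (d.mem_chartDomain_coneAt P.1) hρ', mul_zero]
      · exact fun h => (h (Finset.mem_univ ρ)).elim
    · rw [d.apply_eq_zero (d.mem_chartDomain_coneAt P.1) hρ,
        inverseImageMultiplicity_eq_zero_of_notMem f P fun h =>
          hρ (mem_raysOf.1 (Δ.raysThrough_subset hP (mem_raysThrough.2 h)))]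
      rfl
  · exact ((corresponds_divisorData F).germ_ε m.toAdd).trans
      ((hθ hgen m.toAdd).trans (d.genericHom_torusMonomial m.toAdd))

end DivisorData

end SmoothFan

end Toric

theorem theorem2p1 {N : Type} [AddCommGroup N] [Module.Free ℤ N] [Module.Finite ℤ N]
    (Δ : Toric.SmoothFan N) (Y : Toric.NormalVariety) :
    ∃ Φ : Toric.SmoothFan.MorphismMeetingTorus Δ Y ≃ Toric.SmoothFan.DivisorData Δ Y,
      ∀ f d, Φ f = d ↔ Toric.SmoothFan.Corresponds f d :=
  ⟨Equiv.ofBijective Toric.SmoothFan.MorphismMeetingTorus.divisorData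
    ⟨Toric.SmoothFan.divisorData_injective, fun d => d.exists_morphism⟩,
    fun _ _ => Toric.SmoothFan.divisorData_eq_iff_corresponds⟩
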